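/- **Systems.** For $k\ge 1$ let $A=\langle\Sigma,A_1,\dots,A_k,Q,\lhd\rangle$ be a deterministic parallel communicating finite automata system of degree $k$: $\Sigma$ is a finite input alphabet, $\lhd\notin\Sigma$ is the end-of-input symbol, each component $A_i=\langle S_i,\Sigma,\delta_i,s_{0,i},F_i\rangle$ is a deterministic finite automaton with finite state set $S_i$, initial state $s_{0,i}\in S_i$, accepting states $F_i\subseteq S_i$ and partial transition function $\delta_i:S_i\times(\Sigma\cup\{\lambda,\lhd\})\to S_i$ such that $\delta_i(s,x)$ is undefined for all $x\in\Sigma\cup\{\lhd\}$ whenever $\delta_i(s,\lambda)$ is defined, and $Q=\{q_1,\dots,q_k\}\subseteq\bigcup_i S_i$ is a set of $k$ distinct query states. A configuration consists of the current state and the unread part of the input for every component; on input $w\in\Sigma^*$ the system starts with every $A_i$ in state $s_{0,i}$ with unread part $w\lhd$. If no component is in a query state, then all components simultaneously make an ordinary step, either a $\lambda$-move or a move that consumes the scanned symbol (on $\lhd$ the component stays on $\lhd$). Otherwise a communication step takes place: whenever $A_i$ is in state $q_j$ and the current state $s_j$ of $A_j$ is not in $Q$, the state of $A_i$ becomes $s_j$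 and $A_j$ is reset to $s_{0,j}$ (returning mode), everything else being unchanged; if no request can be served in this way, there is no successor configuration. An input is accepted if the computation reaches a configuration without successor in which, for some $i$, the state $s_i$ of $A_i$ lies in $F_i$ and $\delta_i(s_i,\lambda)$ as well as $\delta_i(s_i,x)$, $x$ being the symbol scanned by $A_i$, are undefined; $L(A)$ is the set of accepted words. $A$ is a $\mathrm{DRCPCFA}(k)$ if it works in this returning mode and is centralized, that is, $S_i\cap Q=\emptyset$ for $2\le i\le k$. For $f:\mathbb N\to\mathbb N$, $A$ is communication bounded by $f$ if every $w\in L(A)$ is accepted by a computation in which the total number of queries sent (the number of time steps at which a component enters a query state, summed over all components) is at most $f(|w|)$. $\mathscr L(O(\log n)\text{-}\mathrm{DRCPCFA}(k))$ is the family of languages $L(A)$ for $\mathrm{DRCPCFA}(k)$s $A$ that are communication bounded by some $f\in O(\log n)$. **Valid computations.** A one-way cellular automaton (OCA) is $M=\langle S,\#,T,\delta,F\rangle$ with a nonempty finite set $S$ of cell states, a boundary state $\#\notin S$, an input alphabet $T\subseteq S$, accepting states $F\subseteq S$ and $\delta:(S\cup\{\#\})\times S\to S$. On input $x_1\cdots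 x_n\in T^n$, $n\ge 1$, its configurations $c_t:\{1,\dots,n\}\to S$ are given by $c_0(i)=x_i$, $c_{t+1}(1)=\delta(\#,c_t(1))$ and $c_{t+1}(i)=\delta(c_t(i-1),c_t(i))$ for $2\le i\le n$. Let $T'$ be a primed copy of $T$ disjoint from $S$, let $S'=S\cup T'$ and $\Gamma=\{\#\}\cup S'\cup S'^2$. Put $w^{(0)}=\#x_1'\cdots x_n'$ and $w^{(t+1)}=w^{(t+1)}_1\cdots w^{(t+1)}_n$, where $$w^{(t+1)}_i=\#\,c_{t+1}(1)\cdots c_{t+1}(i-1)\,(c_{t+1}(i),c_t(i))\,c_t(i+1)\cdots c_t(n).$$ For $y_1\cdots y_r\in\Gamma^+$ with $r\ge 2$ let $g(y_1\cdots y_r)=[y_1,y_2][y_2,y_3]\cdots[y_{r-1},y_r]\in(\Gamma\times\Gamma)^+$. $\mathrm{VALC}(M)\subseteq(\Gamma\times\Gamma)^+$ is the set of all words $g(w^{(0)}w^{(1)}\cdots w^{(p)})$ obtained in this way from some $n\ge 1$, some input $x_1\cdots x_n\in T^n$ and some $p\ge 3$ with $c_p(n)\in F$. **Lemma.** For every OCA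 $M$ the language $$\mathrm{VALC}'(M)=\{\,\$_1x_1x_2\cdots x_m\$_2\,a^{2^0}bb\,a^{2^1}bb\cdots bb\,a^{2^{m-1}}bb\,\&\mid m\ge 1,\ x_1x_2\cdots x_m\in\mathrm{VALC}(M)\,\}$$ over the alphabet $\{a,b,\$_1,\$_2,\&\}\cup(\Gamma\times\Gamma)$, where each $x_i\in\Gamma\times\Gamma$, belongs to $\mathscr L(O(\log n)\text{-}\mathrm{DRCPCFA}(4))$. -/

import Mathlib

/-! ## Deterministic parallel communicating finite automata systems -/

/-- What a transition may consume: an input symbol, nothing (a move on the empty word),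
or the end-of-input symbol (which is not an input symbol). -/
inductive Reading (α : Type) where
  | sym (a : α) : Reading α
  | eps : Reading α
  | endmark : Reading α

/-- A deterministic parallel communicating finite automata system of degree `k` over the input
alphabet `α`.  All component state sets `S i` live in one finite type `State`, so that they may
overlap (states are sent from one component to another).  The master is component `0`. -/
structure DPCFA (k : ℕ) (α : Type) where
  alphabet_finite : Finite α
  State : Type
  state_finite : Finite State
  /-- the state set of component `i` -/
  S : Fin k → Set State
  /-- the partial transition function of component `i` -/
  δ : Fin k → State → Reading α → Option State
  /-- the initial state of component `i` -/
  init : Fin k → State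
  /-- the accepting states of component `i` -/
  F : Fin k → Set State
  /-- `query j` is the query state requesting the current state of component `j` -/
  query : Fin k → State
  δ_mem : ∀ i s r p, δ i s r = some p → s ∈ S i ∧ p ∈ S i
  δ_eps : ∀ i s, δ i s Reading.eps ≠ none → ∀ r, r ≠ Reading.eps → δ i s r = none
  init_mem : ∀ i, init i ∈ S i
  F_subset : ∀ i, F i ⊆ S i
  query_injective : Function.Injective query
  query_mem : ∀ j, ∃ i, query j ∈ S i

namespace DPCFA

variable {k : ℕ} {α : Type}

/-- A configuration: for every component its current state and the unread part of its input.
The end-of-input symbol, which always ends the unread part, is left implicit: the unread part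
`[]` stands for the end-of-input symbol alone. -/
structure Config (A : DPCFA k α) where
  state : Fin k → A.State
  rest : Fin k → List α

/-- The symbol currently scanned. -/
def scanned : List α → Reading α
  | [] => Reading.endmark
  | a :: _ => Reading.sym a

/-- The initial configuration on input `w`. -/
def initial (A : DPCFA k α) (w : List α) : A.Config where
  state := A.init
  rest := fun _ => w

/-- `s` is one of the query states. -/
def IsQuery (A : DPCFA k α) (s : A.State) : Prop := ∃ j, s = A.query j

/-- An ordinary step of component `i`, from state `s` and unread part `x` to state `p` and unread
part `z`.  A component that consumes the end-of-input symbol stays on it. -/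
def LocalStep (A : DPCFA k α) (i : Fin k) (s : A.State) (x : List α) (p : A.State)
    (z : List α) : Prop :=
  (A.δ i s Reading.eps = some p ∧ z = x) ∨ (A.δ i s (scanned x) = some p ∧ z = x.tail)

/-- In configuration `c`, component `i` requests the state of component `j`, and component `j` is
able to send it, as it is not in a query state itself. -/
def Served (A : DPCFA k α) (c : A.Config) (i j : Fin k) : Prop :=
  c.state i = A.query j ∧ ¬ A.IsQuery (c.state j)

/-- The successor relation in returning mode.  If no component is in a query state, all components
make an ordinary step.  Otherwise all requests that can be served are served in a communication
step, in which the senders are set back to their initial states; if no request can be served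
(the requests are cyclic), there is no successor. -/
inductive Step (A : DPCFA k α) : A.Config → A.Config → Prop
  | ordinary (c d : A.Config) :
      (∀ i, ¬ A.IsQuery (c.state i)) →
      (∀ i, A.LocalStep i (c.state i) (c.rest i) (d.state i) (d.rest i)) →
      Step A c d
  | communication (c d : A.Config) :
      (∃ i j, A.Served c i j) →
      (∀ i j, A.Served c i j → d.state i = c.state j ∧ d.state j = A.init j) →
      (∀ r, (∀ j, ¬ A.Served c r j) → (∀ i, ¬ A.Served c i r) → d.state r = c.state r) →
      d.rest = c.rest →
      Step A c d

/-- A configuration is halting if it has no successor. -/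
def Halting (A : DPCFA k α) (c : A.Config) : Prop := ¬ ∃ d, A.Step c d

/-- Some component is in an accepting state and its transition function is undefined for the
current situation. -/
def AcceptingConfig (A : DPCFA k α) (c : A.Config) : Prop :=
  ∃ i, c.state i ∈ A.F i ∧ A.δ i (c.state i) Reading.eps = none ∧
    A.δ i (c.state i) (scanned (c.rest i)) = none

/-- `c 0, c 1, …, c T` is an accepting computation on input `w`. -/
def IsAcceptingComputation (A : DPCFA k α) (w : List α) (T : ℕ) (c : ℕ → A.Config) : Prop :=
  c 0 = A.initial w ∧ (∀ t < T, A.Step (c t) (c (t + 1))) ∧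
    A.Halting (c T) ∧ A.AcceptingConfig (c T)

/-- The language accepted by the system, working in returning mode. -/
def language (A : DPCFA k α) : Language α :=
  {w | ∃ T c, A.IsAcceptingComputation w T c}

/-- Component `i` enters a query state at time `t`. -/
def EntersQuery (A : DPCFA k α) (c : ℕ → A.Config) (t : ℕ) (i : Fin k) : Prop :=
  A.IsQuery ((c t).state i) ∧ (t = 0 ∨ ¬ A.IsQuery ((c (t - 1)).state i))

open Classical in
/-- The total number of queries sent during the computation `c 0, …, c T`: the number of time
steps at which a component enters a query state, summed over all components. -/
noncomputable def queryCount (A : DPCFA k α) (T : ℕ) (c : ℕ → A.Config) : ℕ :=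
  ∑ i : Fin k, ((Finset.range (T + 1)).filter (fun t => A.EntersQuery c t i)).card

/-- The system is communication bounded by `f`. -/
def CommunicationBounded (A : DPCFA k α) (f : ℕ → ℕ) : Prop :=
  ∀ w ∈ A.language, ∃ T c, A.IsAcceptingComputation w T c ∧ A.queryCount T c ≤ f w.length

/-- The system is centralized: no component other than the master has a query state. -/
def Centralized (A : DPCFA k α) : Prop :=
  ∀ i : Fin k, i.val ≠ 0 → ∀ s ∈ A.S i, ¬ A.IsQuery s

end DPCFA

/-- The family of languages over `α` accepted by deterministic returning centralized parallel
communicating finite automata systems of degree `k` that are communication bounded by some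
function of the class `G`. -/
def DRCPCFAFamily (G : Set (ℕ → ℕ)) (k : ℕ) (α : Type) : Set (Language α) :=
  {L | ∃ A : DPCFA k α, A.Centralized ∧ (∃ f ∈ G, A.CommunicationBounded f) ∧ A.language = L}

/-- The class of functions of order `O(log n)`. -/
def bigOLog : Set (ℕ → ℕ) :=
  {f | (fun n => (f n : ℝ)) =O[Filter.atTop] (fun n : ℕ => Real.log n)}

/-! ## One-way cellular automata and their valid computations -/

/-- A one-way cellular automaton.  The boundary state, which is not a cell state, is represented
by `none : Option State`; so `δ (some p) q` is the successor of a cell in state `q` whose left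
neighbor is in state `p`, and `δ none q` that of the leftmost cell in state `q`. -/
structure OCA where
  State : Type
  state_finite : Finite State
  state_nonempty : Nonempty State
  /-- the input alphabet -/
  T : Set State
  δ : Option State → State → State
  /-- the accepting cell states -/
  F : Set State

namespace OCA

/-- The successor configuration of a configuration with `n` cells. -/
def step (M : OCA) {n : ℕ} (c : Fin n → M.State) : Fin n → M.State := fun i =>
  M.δ (if i.val = 0 then none else some (c ⟨i.val - 1, lt_of_le_of_lt (Nat.sub_le _ _) i.isLt⟩))
    (c i)

/-- The configuration at time `t` on input `x`. -/
def config (M : OCA) {n : ℕ} (x : Fin n → M.T) : ℕ → Fin n → M.State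
  | 0 => fun i => (x i : M.State)
  | t + 1 => M.step (M.config x t)

/-- The cell states together with a disjoint primed copy of the input alphabet. -/
inductive CellSym (M : OCA) where
  | st (s : M.State) : CellSym M
  | primed (t : M.T) : CellSym M

/-- The alphabet in which computations are written: the boundary symbol, cell symbols, and pairs
of cell symbols. -/
inductive Letter (M : OCA) where
  | boundary : Letter M
  | cell (p : CellSym M) : Letter M
  | pair (p q : CellSym M) : Letter M

/-- The encoding of the initial configuration: the boundary symbol followed by the primed input. -/
def initialWord (M : OCA) {n : ℕ} (x : Fin n → M.T) : List M.Letter :=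
  Letter.boundary :: List.ofFn (fun i => Letter.cell (CellSym.primed (x i)))

/-- The subconfiguration in which the cells up to cell `i` have been updated from the
configuration `c` to its successor `d`; cell `i` shows its new and its former state. -/
def subconfig (M : OCA) {n : ℕ} (c d : Fin n → M.State) (i : Fin n) : List M.Letter :=
  Letter.boundary :: List.ofFn (fun j =>
    if j < i then Letter.cell (CellSym.st (d j))
    else if j = i then Letter.pair (CellSym.st (d j)) (CellSym.st (c j))
    else Letter.cell (CellSym.st (c j)))

/-- The encoding of the successor `d` of `c`: the sequence of all subconfigurations. -/
def stepWord (M : OCA) {n : ℕ} (c d : Fin n → M.State) : List M.Letter :=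
  (List.ofFn (fun i => M.subconfig c d i)).flatten

/-- The encoding of the computation on input `x` from time `0` to time `m`. -/
def computationWord (M : OCA) {n : ℕ} (x : Fin n → M.T) (m : ℕ) : List M.Letter :=
  M.initialWord x ++
    (List.range m).flatMap (fun t => M.stepWord (M.config x t) (M.config x (t + 1)))

/-- The map `y₁ y₂ ⋯ yₙ ↦ [y₁, y₂] [y₂, y₃] ⋯ [yₙ₋₁, yₙ]`. -/
def pairUp {β : Type} (u : List β) : List (β × β) := u.zip u.tail

/-- The valid computations of `M`: nonempty input, at least three steps, the rightmost cell is in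
an accepting state at the final time; written in the alphabet of pairs of letters. -/
def VALC (M : OCA) : Language (M.Letter × M.Letter) :=
  {v | ∃ (n : ℕ) (x : Fin (n + 1) → M.T) (m : ℕ), 3 ≤ m ∧
    M.config x m (Fin.last n) ∈ M.F ∧ v = pairUp (M.computationWord x m)}

/-- The input alphabet `{a, b, $₁, $₂, &}` extended by all pairs of letters. -/
inductive TapeSym (M : OCA) where
  | a : TapeSym M
  | b : TapeSym M
  | dollar₁ : TapeSym M
  | dollar₂ : TapeSym M
  | amp : TapeSym M
  | comp (p : M.Letter × M.Letter) : TapeSym M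

/-- The word `a^(2^0) bb a^(2^1) bb ⋯ bb a^(2^(m-1)) bb`. -/
def doublingBlocks (M : OCA) (m : ℕ) : List M.TapeSym :=
  (List.range m).flatMap (fun i => List.replicate (2 ^ i) TapeSym.a ++ [TapeSym.b, TapeSym.b])

/-- The words `$₁ x₁ ⋯ x_m $₂ a^(2^0) bb a^(2^1) bb ⋯ bb a^(2^(m-1)) bb &` with `m ≥ 1` and
`x₁ ⋯ x_m` a valid computation of `M`. -/
def VALCExp (M : OCA) : Language M.TapeSym :=
  {w | ∃ v ∈ M.VALC, 1 ≤ v.length ∧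
    w = [TapeSym.dollar₁] ++ v.map TapeSym.comp ++ [TapeSym.dollar₂] ++
      M.doublingBlocks v.length ++ [TapeSym.amp]}

end OCA

/-! The padding makes queries cheap. A word of the language that contains m pairs of letters has
length at least 2^m, so a constant number of queries per pair is logarithmic in the input length.

Checking the computation. A letter of a subconfiguration is determined by the letter at the same
position of the preceding one and by the left neighbour of the latter (`Compat`), except directly
behind a boundary symbol. There one must also know whether a new sweep begins, and a finite
automaton (`Phase`) knows it. The lagging client stays one subconfiguration behind the master and
sends it one pair per query, so the master can test `Compat`; meanwhile the halving client runs the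
automaton. `Walk` combines both tests: `walk_inv` and `walk_accepts` say that the components perform
it, `walk_iff_exists_computationWord` that it characterizes the valid computations.

Checking the padding. The halving client stays one block behind the master and spends two steps on
each `a`. If it reaches the end of its block at the same time as the master, the master's block is
twice as long. The counting client advances by one pair per request, so one request per block
compares the number of blocks with the number of pairs (`blocks_inv`, `blocks_accepts`).

Cost. There is one query per compared letter and two per block, at most 3 * m in all
(`accepts_padded`), and `two_pow_le_length_padded` turns this into a logarithm. All runs are
analysed on the inductive predicate `Program.Accepts`, which `mem_language_iff` and
`exists_computation_of_accepts` link to the actual systems. -/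

open DPCFA

/-! ## Centralized systems of degree four with typed components -/


/-- The program of a centralized system of degree four.  Only the master may ask for the state of
another component, so its moves lead to a query (`Sum.inl`) or to a working state (`Sum.inr`). -/
structure Program (α W : Type) where
  master : W → Reading α → Option (Fin 4 ⊕ W)
  client₁ : W → Reading α → Option W
  client₂ : W → Reading α → Option W
  client₃ : W → Reading α → Option W
  start₀ : W
  start₁ : W
  start₂ : W
  start₃ : W
  accept : W
  accept_halts : ∀ r, master accept r = none
  master_eps : ∀ s, master s .eps ≠ none → ∀ r, r ≠ .eps → master s r = none
  client₁_eps : ∀ s, client₁ s .eps ≠ none → ∀ r, r ≠ .eps → client₁ s r = none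
  client₂_eps : ∀ s, client₂ s .eps ≠ none → ∀ r, r ≠ .eps → client₂ s r = none
  client₃_eps : ∀ s, client₃ s .eps ≠ none → ∀ r, r ≠ .eps → client₃ s r = none

/-- A configuration of a centralized system of degree four. -/
structure Run (α W : Type) where
  s₀ : Fin 4 ⊕ W
  s₁ : W
  s₂ : W
  s₃ : W
  r₀ : List α
  r₁ : List α
  r₂ : List α
  r₃ : List α

/-- The ordinary move of a single component. -/
def move {α W V : Type} (δ : W → Reading α → Option V) (s : W) (x : List α) :
    Option (V × List α) :=
  match δ s .eps with
  | some p => some (p, x)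
  | none => (δ s (scanned x)).map fun p => (p, x.tail)

/-- The right side permits either kind of move whereas `move` prefers the empty word; `hδ` excludes
a conflict. -/
theorem move_eq_some_iff {α W V : Type} {δ : W → Reading α → Option V}
    (hδ : ∀ s, δ s .eps ≠ none → ∀ r, r ≠ .eps → δ s r = none) (s : W) (x : List α) (p : V)
    (z : List α) :
    move δ s x = some (p, z) ↔
      (δ s .eps = some p ∧ z = x) ∨ (δ s (scanned x) = some p ∧ z = x.tail) := by
  have hs : scanned x ≠ .eps := by cases x <;> simp [scanned]
  unfold move
  rcases h : δ s .eps with _ | p'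
  · simp [eq_comm]
  · have h' := hδ s (by simp [h]) _ hs
    simp [h', eq_comm]

namespace Program

variable {α W : Type}

/-- The transition functions of the components on the common state set. -/
def trans (P : Program α W) (i : Fin 4) : Fin 4 ⊕ W → Reading α → Option (Fin 4 ⊕ W)
  | .inl _, _ => none
  | .inr w, r => ![P.master w r, (P.client₁ w r).map .inr, (P.client₂ w r).map .inr,
      (P.client₃ w r).map .inr] i

/-- The system described by a program. -/
def toDPCFA [Finite α] [Finite W] (P : Program α W) : DPCFA 4 α where
  alphabet_finite := inferInstance
  State := Fin 4 ⊕ W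
  state_finite := inferInstance
  -- All components share the working states, since the master continues from whatever state a
  -- client has sent.
  S i := {s | i = 0 ∨ ∃ w, s = .inr w}
  δ := P.trans
  init := ![.inr P.start₀, .inr P.start₁, .inr P.start₂, .inr P.start₃]
  F i := {s | i = 0 ∧ s = .inr P.accept}
  query := .inl
  δ_mem := by
    intro i s r p h
    rcases s with s | s
    · simp [trans] at h
    · refine ⟨.inr ⟨s, rfl⟩, ?_⟩
      fin_cases i
      · exact .inl rfl
      all_goals
        simp only [trans] at h
        obtain ⟨w, -, hw⟩ := Option.map_eq_some_iff.1 h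
        exact .inr ⟨w, hw.symm⟩
  δ_eps := by
    intro i s h r hr
    rcases s with s | s
    · rfl
    · fin_cases i
      · exact P.master_eps s h r hr
      · simpa [trans] using P.client₁_eps s (by simpa [trans] using h) r hr
      · simpa [trans] using P.client₂_eps s (by simpa [trans] using h) r hr
      · simpa [trans] using P.client₃_eps s (by simpa [trans] using h) r hr
  init_mem := by
    intro i
    fin_cases i
    · exact .inl rfl
    all_goals exact .inr ⟨_, rfl⟩
  F_subset := by
    rintro i s ⟨h, -⟩
    exact .inl h
  query_injective := Sum.inl_injective
  query_mem := fun _ => ⟨0, .inl rfl⟩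

/-- The run `c` is accepted, and `n` queries are sent until then. -/
inductive Accepts (P : Program α W) : Run α W → ℕ → Prop
  | done (m s₁ s₂ s₃ r₀ r₁ r₂ r₃) : m = P.accept → Accepts P ⟨.inr m, s₁, s₂, s₃, r₀, r₁, r₂, r₃⟩ 0
  | work (m s₁ s₂ s₃ r₀ r₁ r₂ r₃ m' s₁' s₂' s₃' r₀' r₁' r₂' r₃' n) :
      move P.master m r₀ = some (m', r₀') → move P.client₁ s₁ r₁ = some (s₁', r₁') →
      move P.client₂ s₂ r₂ = some (s₂', r₂') → move P.client₃ s₃ r₃ = some (s₃', r₃') →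
      Accepts P ⟨m', s₁', s₂', s₃', r₀', r₁', r₂', r₃'⟩ n →
      Accepts P ⟨.inr m, s₁, s₂, s₃, r₀, r₁, r₂, r₃⟩ n
  -- There is no rule for a query of the master to itself: it is never served, and the system halts
  -- without accepting.
  | ask₁ (s₁ s₂ s₃ r₀ r₁ r₂ r₃ n) :
      Accepts P ⟨.inr s₁, P.start₁, s₂, s₃, r₀, r₁, r₂, r₃⟩ n →
      Accepts P ⟨.inl 1, s₁, s₂, s₃, r₀, r₁, r₂, r₃⟩ (n + 1)
  | ask₂ (s₁ s₂ s₃ r₀ r₁ r₂ r₃ n) :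
      Accepts P ⟨.inr s₂, s₁, P.start₂, s₃, r₀, r₁, r₂, r₃⟩ n →
      Accepts P ⟨.inl 2, s₁, s₂, s₃, r₀, r₁, r₂, r₃⟩ (n + 1)
  | ask₃ (s₁ s₂ s₃ r₀ r₁ r₂ r₃ n) :
      Accepts P ⟨.inr s₃, s₁, s₂, P.start₃, r₀, r₁, r₂, r₃⟩ n →
      Accepts P ⟨.inl 3, s₁, s₂, s₃, r₀, r₁, r₂, r₃⟩ (n + 1)

namespace Accepts

variable {P : Program α W} {m s₁ s₂ s₃ : W} {r₀ r₁ r₂ r₃ : List α} {n : ℕ}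

theorem work_inv (h : P.Accepts ⟨.inr m, s₁, s₂, s₃, r₀, r₁, r₂, r₃⟩ n) (hm : m ≠ P.accept) :
    ∃ m' s₁' s₂' s₃' r₀' r₁' r₂' r₃', move P.master m r₀ = some (m', r₀') ∧
      move P.client₁ s₁ r₁ = some (s₁', r₁') ∧ move P.client₂ s₂ r₂ = some (s₂', r₂') ∧
      move P.client₃ s₃ r₃ = some (s₃', r₃') ∧
      P.Accepts ⟨m', s₁', s₂', s₃', r₀', r₁', r₂', r₃'⟩ n := by
  cases h with
  | done _ _ _ _ _ _ _ _ h => exact absurd h hm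
  | work _ _ _ _ _ _ _ _ m' s₁' s₂' s₃' r₀' r₁' r₂' r₃' _ h₀ h₁ h₂ h₃ h =>
    exact ⟨m', s₁', s₂', s₃', r₀', r₁', r₂', r₃', h₀, h₁, h₂, h₃, h⟩

theorem ask₁_inv (h : P.Accepts ⟨.inl 1, s₁, s₂, s₃, r₀, r₁, r₂, r₃⟩ n) :
    ∃ n', P.Accepts ⟨.inr s₁, P.start₁, s₂, s₃, r₀, r₁, r₂, r₃⟩ n' := by
  cases h with
  | ask₁ _ _ _ _ _ _ _ n h => exact ⟨n, h⟩

theorem ask₂_inv (h : P.Accepts ⟨.inl 2, s₁, s₂, s₃, r₀, r₁, r₂, r₃⟩ n) :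
    ∃ n', P.Accepts ⟨.inr s₂, s₁, P.start₂, s₃, r₀, r₁, r₂, r₃⟩ n' := by
  cases h with
  | ask₂ _ _ _ _ _ _ _ n h => exact ⟨n, h⟩

theorem ask₃_inv (h : P.Accepts ⟨.inl 3, s₁, s₂, s₃, r₀, r₁, r₂, r₃⟩ n) :
    ∃ n', P.Accepts ⟨.inr s₃, s₁, s₂, P.start₃, r₀, r₁, r₂, r₃⟩ n' := by
  cases h with
  | ask₃ _ _ _ _ _ _ _ n h => exact ⟨n, h⟩

end Accepts

/-! ### Runs of a program and computations of its system -/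

variable [Finite α] [Finite W] (P : Program α W)

/-- The configuration of the system that corresponds to a run configuration. -/
def config (c : Run α W) : P.toDPCFA.Config where
  state := ![c.s₀, .inr c.s₁, .inr c.s₂, .inr c.s₃]
  rest := ![c.r₀, c.r₁, c.r₂, c.r₃]

/-- The initial run configuration. -/
def initialRun (w : List α) : Run α W :=
  ⟨.inr P.start₀, P.start₁, P.start₂, P.start₃, w, w, w, w⟩

theorem config_initialRun (w : List α) : P.config (P.initialRun w) = P.toDPCFA.initial w := by
  simp only [config, initialRun, DPCFA.initial, toDPCFA, Config.mk.injEq, true_and]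
  funext i
  fin_cases i <;> rfl

theorem not_isQuery_inr (w : W) : ¬ P.toDPCFA.IsQuery (Sum.inr w : Fin 4 ⊕ W) := by
  rintro ⟨j, hj⟩
  cases hj

theorem centralized : P.toDPCFA.Centralized := by
  rintro i hi s (h | ⟨w, rfl⟩)
  · exact absurd (congrArg Fin.val h) hi
  · exact P.not_isQuery_inr w

theorem localStep_client₁_iff {s : W} {x z : List α} {p : Fin 4 ⊕ W} :
    P.toDPCFA.LocalStep 1 (.inr s : Fin 4 ⊕ W) x p z ↔
      ∃ p', p = .inr p' ∧ move P.client₁ s x = some (p', z) := by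
  simp only [move_eq_some_iff P.client₁_eps]
  simp only [LocalStep, toDPCFA, trans, Matrix.cons_val, Option.map_eq_some_iff]
  grind

theorem localStep_client₂_iff {s : W} {x z : List α} {p : Fin 4 ⊕ W} :
    P.toDPCFA.LocalStep 2 (.inr s : Fin 4 ⊕ W) x p z ↔
      ∃ p', p = .inr p' ∧ move P.client₂ s x = some (p', z) := by
  simp only [move_eq_some_iff P.client₂_eps]
  simp only [LocalStep, toDPCFA, trans, Matrix.cons_val, Option.map_eq_some_iff]
  grind

theorem localStep_client₃_iff {s : W} {x z : List α} {p : Fin 4 ⊕ W} :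
    P.toDPCFA.LocalStep 3 (.inr s : Fin 4 ⊕ W) x p z ↔
      ∃ p', p = .inr p' ∧ move P.client₃ s x = some (p', z) := by
  simp only [move_eq_some_iff P.client₃_eps]
  simp only [LocalStep, toDPCFA, trans, Matrix.cons_val, Option.map_eq_some_iff]
  grind

theorem localStep_master_iff {s : W} {x z : List α} {p : Fin 4 ⊕ W} :
    P.toDPCFA.LocalStep 0 (.inr s : Fin 4 ⊕ W) x p z ↔ move P.master s x = some (p, z) :=
  (move_eq_some_iff P.master_eps s x p z).symm

theorem config_ext {c : P.toDPCFA.Config} {d : Run α W} (h₀ : c.state 0 = d.s₀)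
    (h₁ : c.state 1 = (.inr d.s₁ : Fin 4 ⊕ W)) (h₂ : c.state 2 = (.inr d.s₂ : Fin 4 ⊕ W))
    (h₃ : c.state 3 = (.inr d.s₃ : Fin 4 ⊕ W)) (k₀ : c.rest 0 = d.r₀) (k₁ : c.rest 1 = d.r₁)
    (k₂ : c.rest 2 = d.r₂) (k₃ : c.rest 3 = d.r₃) : c = P.config d := by
  obtain ⟨s, r⟩ := c
  simp only [config, Config.mk.injEq]
  constructor
  · funext i
    fin_cases i <;> assumption
  · funext i
    fin_cases i <;> assumption

theorem step_work {m s₁ s₂ s₃ s₁' s₂' s₃' : W} {m' : Fin 4 ⊕ W}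
    {r₀ r₁ r₂ r₃ r₀' r₁' r₂' r₃' : List α}
    (h₀ : move P.master m r₀ = some (m', r₀')) (h₁ : move P.client₁ s₁ r₁ = some (s₁', r₁'))
    (h₂ : move P.client₂ s₂ r₂ = some (s₂', r₂')) (h₃ : move P.client₃ s₃ r₃ = some (s₃', r₃')) :
    P.toDPCFA.Step (P.config ⟨.inr m, s₁, s₂, s₃, r₀, r₁, r₂, r₃⟩)
      (P.config ⟨m', s₁', s₂', s₃', r₀', r₁', r₂', r₃'⟩) := by
  apply Step.ordinary
  · intro i
    fin_cases i <;> exact P.not_isQuery_inr _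
  · intro i
    fin_cases i
    · exact P.localStep_master_iff.2 h₀
    · exact P.localStep_client₁_iff.2 ⟨_, rfl, h₁⟩
    · exact P.localStep_client₂_iff.2 ⟨_, rfl, h₂⟩
    · exact P.localStep_client₃_iff.2 ⟨_, rfl, h₃⟩

/-- Clients are never in query states, so the only request is the master's; it fails only if
addressed to the master, which is itself in a query state. -/
theorem served_iff {j : Fin 4} {s₁ s₂ s₃ : W} {r₀ r₁ r₂ r₃ : List α} (i l : Fin 4) :
    P.toDPCFA.Served (P.config ⟨.inl j, s₁, s₂, s₃, r₀, r₁, r₂, r₃⟩) i l ↔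
      i = 0 ∧ l = j ∧ j ≠ 0 := by
  have hq : ∀ a : Fin 4, P.toDPCFA.query a = (Sum.inl a : Fin 4 ⊕ W) := fun _ => rfl
  have hi : ∀ a : Fin 4, P.toDPCFA.IsQuery (Sum.inl a : Fin 4 ⊕ W) := fun a => ⟨a, rfl⟩
  constructor
  · rintro ⟨h, h'⟩
    have hi0 : i = 0 := by
      by_contra hne
      fin_cases i
      · exact hne rfl
      all_goals cases h
    subst hi0
    have hl : j = l := Sum.inl_injective h
    subst hl
    refine ⟨rfl, rfl, ?_⟩
    rintro rfl
    exact h' (hi _)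
  · rintro ⟨rfl, rfl, h⟩
    refine ⟨rfl, ?_⟩
    fin_cases l
    · exact absurd rfl h
    all_goals exact P.not_isQuery_inr _

/-- The single request determines the successor. For `j = 0` every disjunct fails: there is no
successor. -/
theorem step_ask_iff {j : Fin 4} {s₁ s₂ s₃ : W} {r₀ r₁ r₂ r₃ : List α} (d : P.toDPCFA.Config) :
    P.toDPCFA.Step (P.config ⟨.inl j, s₁, s₂, s₃, r₀, r₁, r₂, r₃⟩) d ↔
      (j = 1 ∧ d = P.config ⟨.inr s₁, P.start₁, s₂, s₃, r₀, r₁, r₂, r₃⟩) ∨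
      (j = 2 ∧ d = P.config ⟨.inr s₂, s₁, P.start₂, s₃, r₀, r₁, r₂, r₃⟩) ∨
      (j = 3 ∧ d = P.config ⟨.inr s₃, s₁, s₂, P.start₃, r₀, r₁, r₂, r₃⟩) := by
  constructor
  · intro h
    cases h with
    | ordinary h _ => exact absurd ⟨j, rfl⟩ (h 0)
    | communication h h' h'' hr =>
      simp only [served_iff] at h h' h''
      obtain ⟨-, -, -, -, hj⟩ := h
      obtain ⟨hm, hs⟩ := h' 0 j ⟨rfl, rfl, hj⟩
      have hc : ∀ r : Fin 4, r ≠ 0 → r ≠ j → d.state r = (P.config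
          ⟨.inl j, s₁, s₂, s₃, r₀, r₁, r₂, r₃⟩).state r :=
        fun r hr0 hrj => h'' r (by tauto) (by tauto)
      fin_cases j
      · exact absurd rfl hj
      · exact .inl ⟨rfl, P.config_ext hm hs (hc 2 (by decide) (by decide))
          (hc 3 (by decide) (by decide)) (congrFun hr 0) (congrFun hr 1) (congrFun hr 2)
          (congrFun hr 3)⟩
      · exact .inr (.inl ⟨rfl, P.config_ext hm (hc 1 (by decide) (by decide)) hs
          (hc 3 (by decide) (by decide)) (congrFun hr 0) (congrFun hr 1) (congrFun hr 2)
          (congrFun hr 3)⟩)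
      · exact .inr (.inr ⟨rfl, P.config_ext hm (hc 1 (by decide) (by decide))
          (hc 2 (by decide) (by decide)) hs (congrFun hr 0) (congrFun hr 1) (congrFun hr 2)
          (congrFun hr 3)⟩)
  · have key : ∀ d : P.toDPCFA.Config, j ≠ 0 →
        (d.state 0 = (P.config ⟨.inl j, s₁, s₂, s₃, r₀, r₁, r₂, r₃⟩).state j ∧
          d.state j = P.toDPCFA.init j) →
        (∀ r, r ≠ 0 → r ≠ j →
          d.state r = (P.config ⟨.inl j, s₁, s₂, s₃, r₀, r₁, r₂, r₃⟩).state r) →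
        d.rest = (P.config ⟨.inl j, s₁, s₂, s₃, r₀, r₁, r₂, r₃⟩).rest →
        P.toDPCFA.Step (P.config ⟨.inl j, s₁, s₂, s₃, r₀, r₁, r₂, r₃⟩) d := by
      intro d hj h h' hr
      apply Step.communication
      · exact ⟨0, j, (P.served_iff _ _).2 ⟨rfl, rfl, hj⟩⟩
      · intro i l hil
        obtain ⟨rfl, rfl, -⟩ := (P.served_iff _ _).1 hil
        exact h
      · intro r h₁ h₂
        simp only [served_iff] at h₁ h₂
        refine h' r (fun h => h₁ j ⟨h, rfl, hj⟩) (fun h => h₂ 0 ⟨rfl, h, hj⟩)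
      · exact hr
    rintro (⟨rfl, rfl⟩ | ⟨rfl, rfl⟩ | ⟨rfl, rfl⟩)
    all_goals
      refine key _ (by decide) ⟨rfl, rfl⟩ ?_ rfl
      intro r h0 hj
      fin_cases r <;> first | rfl | exact absurd rfl h0 | exact absurd rfl hj

/-- Only the master has an accepting state, so the last configuration is an instance of `done`; the
earlier steps are prepended one by one. -/
theorem exists_accepts_of_computation (T : ℕ) : ∀ (c : Run α W) (f : ℕ → P.toDPCFA.Config),
    f 0 = P.config c → (∀ t < T, P.toDPCFA.Step (f t) (f (t + 1))) →
    P.toDPCFA.AcceptingConfig (f T) → ∃ n, P.Accepts c n := by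
  induction T with
  | zero =>
    rintro c f h0 - ⟨i, ⟨hi, hs⟩, -⟩
    obtain ⟨m, s₁, s₂, s₃, r₀, r₁, r₂, r₃⟩ := c
    subst hi
    rw [h0] at hs
    have hm : m = .inr P.accept := hs
    subst hm
    exact ⟨0, .done _ _ _ _ _ _ _ _ rfl⟩
  | succ T ih =>
    intro c f h0 hstep hacc
    have h1 := hstep 0 (by omega)
    rw [h0] at h1
    have next : ∀ d, f 1 = P.config d → ∃ n, P.Accepts d n := fun d hd =>
      ih d (fun t => f (t + 1)) hd (fun t ht => hstep (t + 1) (by omega)) hacc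
    obtain ⟨m | m, s₁, s₂, s₃, r₀, r₁, r₂, r₃⟩ := c
    · rcases (P.step_ask_iff _).1 h1 with ⟨rfl, h⟩ | ⟨rfl, h⟩ | ⟨rfl, h⟩
      · obtain ⟨n, hn⟩ := next _ h
        exact ⟨_, .ask₁ _ _ _ _ _ _ _ _ hn⟩
      · obtain ⟨n, hn⟩ := next _ h
        exact ⟨_, .ask₂ _ _ _ _ _ _ _ _ hn⟩
      · obtain ⟨n, hn⟩ := next _ h
        exact ⟨_, .ask₃ _ _ _ _ _ _ _ _ hn⟩
    · cases h1 with
      | ordinary _ h =>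
        have h₀ := P.localStep_master_iff.1 (h 0)
        obtain ⟨s₁', e₁, h₁⟩ := P.localStep_client₁_iff.1 (h 1)
        obtain ⟨s₂', e₂, h₂⟩ := P.localStep_client₂_iff.1 (h 2)
        obtain ⟨s₃', e₃, h₃⟩ := P.localStep_client₃_iff.1 (h 3)
        obtain ⟨n, hn⟩ := next ⟨_, s₁', s₂', s₃', _, _, _, _⟩
          (P.config_ext rfl e₁ e₂ e₃ rfl rfl rfl rfl)
        exact ⟨_, .work _ _ _ _ _ _ _ _ _ _ _ _ _ _ _ _ _ h₀ h₁ h₂ h₃ hn⟩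
      | communication h _ _ _ =>
        obtain ⟨i, l, ⟨h, -⟩⟩ := h
        fin_cases i <;> cases h

theorem halting_accept {c : Run α W} (h : c.s₀ = .inr P.accept) :
    P.toDPCFA.Halting (P.config c) ∧ P.toDPCFA.AcceptingConfig (P.config c) := by
  obtain ⟨m, s₁, s₂, s₃, r₀, r₁, r₂, r₃⟩ := c
  obtain rfl : m = .inr P.accept := h
  constructor
  · rintro ⟨d, hd⟩
    cases hd with
    | ordinary _ h =>
      have h₀ := P.localStep_master_iff.1 (h 0)
      simp [move, P.accept_halts] at h₀
    | communication h _ _ _ =>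
      obtain ⟨i, l, ⟨h, -⟩⟩ := h
      fin_cases i <;> cases h
  · exact ⟨0, ⟨rfl, rfl⟩, P.accept_halts _, P.accept_halts _⟩

/-- Cost is measured by the times at which the master is in a query state; `b` bounds the share of
the new first configuration. -/
theorem computation_cons {c d : Run α W} {n b : ℕ}
    (hcd : P.toDPCFA.Step (P.config c) (P.config d)) (hb : (if c.s₀.isLeft then 1 else 0) ≤ b)
    (h : ∃ (T : ℕ) (g : ℕ → Run α W), g 0 = d ∧
      (∀ t < T, P.toDPCFA.Step (P.config (g t)) (P.config (g (t + 1)))) ∧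
      (g T).s₀ = .inr P.accept ∧
      ∑ t ∈ Finset.range (T + 1), (if (g t).s₀.isLeft then 1 else 0) ≤ n) :
    ∃ (T : ℕ) (g : ℕ → Run α W), g 0 = c ∧
      (∀ t < T, P.toDPCFA.Step (P.config (g t)) (P.config (g (t + 1)))) ∧
      (g T).s₀ = .inr P.accept ∧
      ∑ t ∈ Finset.range (T + 1), (if (g t).s₀.isLeft then 1 else 0) ≤ n + b := by
  obtain ⟨T, g, rfl, hs, ha, hq⟩ := h
  refine ⟨T + 1, fun t => Nat.casesOn t c g, rfl, ?_, ha, ?_⟩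
  · rintro (_ | t) ht
    · exact hcd
    · exact hs t (by omega)
  · rw [Finset.sum_range_succ']
    exact Nat.add_le_add hq hb

theorem computation_of_accepts {c : Run α W} {n : ℕ} (h : P.Accepts c n) :
    ∃ (T : ℕ) (g : ℕ → Run α W), g 0 = c ∧
      (∀ t < T, P.toDPCFA.Step (P.config (g t)) (P.config (g (t + 1)))) ∧
      (g T).s₀ = .inr P.accept ∧
      ∑ t ∈ Finset.range (T + 1), (if (g t).s₀.isLeft then 1 else 0) ≤ n := by
  induction h with
  | done m s₁ s₂ s₃ r₀ r₁ r₂ r₃ h =>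
    subst h
    exact ⟨0, fun _ => _, rfl, by simp, rfl, by simp⟩
  | work _ _ _ _ _ _ _ _ _ _ _ _ _ _ _ _ _ h₀ h₁ h₂ h₃ _ ih =>
    exact P.computation_cons (b := 0) (P.step_work h₀ h₁ h₂ h₃) (by simp) ih
  | ask₁ _ _ _ _ _ _ _ _ _ ih =>
    exact P.computation_cons (b := 1) ((P.step_ask_iff _).2 (.inl ⟨rfl, rfl⟩)) (by simp) ih
  | ask₂ _ _ _ _ _ _ _ _ _ ih =>
    exact P.computation_cons (b := 1) ((P.step_ask_iff _).2 (.inr (.inl ⟨rfl, rfl⟩))) (by simp) ih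
  | ask₃ _ _ _ _ _ _ _ _ _ ih =>
    exact P.computation_cons (b := 1) ((P.step_ask_iff _).2 (.inr (.inr ⟨rfl, rfl⟩))) (by simp) ih

/-- Entering a query state implies being in one, and only the master can, so the visits of the
master to query states bound the queries. -/
theorem exists_computation_of_accepts {w : List α} {n : ℕ} (h : P.Accepts (P.initialRun w) n) :
    ∃ T c, P.toDPCFA.IsAcceptingComputation w T c ∧ P.toDPCFA.queryCount T c ≤ n := by
  obtain ⟨T, g, h0, hs, ha, hq⟩ := P.computation_of_accepts h
  refine ⟨T, fun t => P.config (g t), ⟨?_, hs, P.halting_accept ha⟩, ?_⟩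
  · simp only [h0]
    exact P.config_initialRun w
  · refine le_trans ?_ hq
    rw [Finset.sum_boole]
    simp only [queryCount, Fin.sum_univ_four, Nat.cast_id]
    have hz : ∀ i : Fin 4, i ≠ 0 → ∀ t,
        ¬ P.toDPCFA.EntersQuery (fun t => P.config (g t)) t i := by
      rintro i hi t ⟨h, -⟩
      fin_cases i
      · exact hi rfl
      all_goals exact P.not_isQuery_inr _ h
    simp only [hz 1 (by decide), hz 2 (by decide), hz 3 (by decide), Finset.filter_false,
      Finset.card_empty, add_zero]
    apply Finset.card_le_card
    intro t ht
    simp only [Finset.mem_filter] at ht ⊢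
    refine ⟨ht.1, ?_⟩
    obtain ⟨j, hj⟩ := ht.2.1
    have : (g t).s₀ = .inl j := hj
    simp [this]

theorem mem_language_iff (w : List α) :
    w ∈ P.toDPCFA.language ↔ ∃ n, P.Accepts (P.initialRun w) n := by
  constructor
  · rintro ⟨T, f, h0, hs, -, ha⟩
    exact P.exists_accepts_of_computation T _ f (h0.trans (P.config_initialRun w).symm) hs ha
  · rintro ⟨n, hn⟩
    obtain ⟨T, c, h, -⟩ := P.exists_computation_of_accepts hn
    exact ⟨T, c, h⟩

end Program

namespace Program.Accepts

variable {α W : Type} {P : Program α W} {m s₁ s₂ s₃ s₁' s₂' s₃' : W} {m' : Fin 4 ⊕ W}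
  {r₀ r₁ r₂ r₃ r₀' r₁' r₂' r₃' : List α} {n : ℕ}

/-- An ordinary step, with implicit configurations. -/
theorem of_work (h₀ : move P.master m r₀ = some (m', r₀'))
    (h₁ : move P.client₁ s₁ r₁ = some (s₁', r₁')) (h₂ : move P.client₂ s₂ r₂ = some (s₂', r₂'))
    (h₃ : move P.client₃ s₃ r₃ = some (s₃', r₃'))
    (h : P.Accepts ⟨m', s₁', s₂', s₃', r₀', r₁', r₂', r₃'⟩ n) :
    P.Accepts ⟨.inr m, s₁, s₂, s₃, r₀, r₁, r₂, r₃⟩ n :=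
  .work _ _ _ _ _ _ _ _ _ _ _ _ _ _ _ _ _ h₀ h₁ h₂ h₃ h

/-- Inversion of an ordinary step in which the moves of the clients are known. -/
theorem work_det (h : P.Accepts ⟨.inr m, s₁, s₂, s₃, r₀, r₁, r₂, r₃⟩ n) (hm : m ≠ P.accept)
    (h₁ : move P.client₁ s₁ r₁ = some (s₁', r₁')) (h₂ : move P.client₂ s₂ r₂ = some (s₂', r₂'))
    (h₃ : move P.client₃ s₃ r₃ = some (s₃', r₃')) :
    ∃ m' r₀', move P.master m r₀ = some (m', r₀') ∧
      P.Accepts ⟨m', s₁', s₂', s₃', r₀', r₁', r₂', r₃'⟩ n := by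
  obtain ⟨m', _, _, _, r₀', _, _, _, k₀, k₁, k₂, k₃, h⟩ := h.work_inv hm
  obtain ⟨rfl, rfl⟩ := Prod.mk.inj (Option.some.inj (h₁.symm.trans k₁))
  obtain ⟨rfl, rfl⟩ := Prod.mk.inj (Option.some.inj (h₂.symm.trans k₂))
  obtain ⟨rfl, rfl⟩ := Prod.mk.inj (Option.some.inj (h₃.symm.trans k₃))
  exact ⟨m', r₀', k₀, h⟩

end Program.Accepts

namespace OCA

variable (M : OCA)

/-! ## The checks on single letters -/

/-- The states of the automaton that checks the shape of a sequence of subconfigurations.  The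
number `k` counts the completed sweeps, up to three. -/
inductive Phase where
  /-- the initial boundary symbol has been read -/
  | opening
  /-- a part of the primed input has been read -/
  | input
  /-- the boundary symbol after the primed input has been read -/
  | sync
  /-- a boundary symbol has been read, the next cell is the active one -/
  | first (k : Fin 4)
  /-- a boundary symbol has been read, the next cell is not the active one -/
  | lead₀ (k : Fin 4)
  /-- the active cell comes later -/
  | lead (k : Fin 4)
  /-- the active cell, whose new state is `d`, has been read -/
  | just (d : M.State) (k : Fin 4)
  /-- the active cell has been read earlier -/
  | trail (k : Fin 4)

variable {M}

/-- Count one more sweep. -/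
def bump (k : Fin 4) : Fin 4 := ⟨min (k.val + 1) 3, by omega⟩

namespace Phase

/-- The transition function of the shape checking automaton. -/
def next : M.Phase → M.Letter → Option M.Phase
  | opening, .cell (.primed _) => some input
  | input, .cell (.primed _) => some input
  | input, .boundary => some sync
  | first k, .pair (.st d) (.st _) => some (just d (bump k))
  | lead₀ k, .cell (.st _) => some (lead k)
  | lead k, .cell (.st _) => some (lead k)
  | lead k, .pair (.st d) (.st _) => some (just d k)
  | just _ k, .cell (.st _) => some (trail k)
  -- A boundary symbol opens a new sweep exactly when the last cell was active. This settles the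
  -- choice that `Compat` leaves behind a boundary symbol.
  | just _ k, .boundary => some (first k)
  | trail k, .cell (.st _) => some (trail k)
  | trail k, .boundary => some (lead₀ k)
  | _, _ => none

/-- The move on the empty word that ends the phase `sync`. -/
def release : M.Phase → Option M.Phase
  | sync => some (first 0)
  | _ => none

/-- The accepting phases. -/
def Final : M.Phase → Prop
  | just d k => d ∈ M.F ∧ k = 3
  | _ => False

/-- The phases after the primed input. -/
def Late : M.Phase → Prop
  | opening | input | sync => False
  | _ => True

theorem Late.release_eq {s : M.Phase} (h : s.Late) : s.release = none := by
  cases s <;> first | rfl | exact h.elim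

theorem Late.next {s s' : M.Phase} {y : M.Letter} (h : s.Late) (h' : s.next y = some s') :
    s'.Late := by
  revert h'
  unfold Phase.next
  split <;> rintro h' <;> cases h' <;> first | exact h.elim | trivial

theorem next_of_release {s : M.Phase} (h : s.release ≠ none) (y : M.Letter) : s.next y = none := by
  cases s <;> first | rfl | exact absurd rfl h

theorem not_final_of_release {s : M.Phase} (h : s.release ≠ none) : ¬ s.Final := by
  cases s <;> first | exact id | exact absurd rfl h

end Phase

/-- The most recent state of a cell. -/
def value : M.Letter → Option M.State
  | .cell (.st s) => some s
  | .cell (.primed t) => some t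
  | .pair (.st d) _ => some d
  | _ => none

/-- `y` is a possible letter for a position if the letter of this position in the preceding
subconfiguration is `q`, and `p` is the letter before `q`. -/
def Compat (p q y : M.Letter) : Prop :=
  match value q with
  | none => y = .boundary
  | some s =>
    match p with
    | .boundary => y = .cell (.st s) ∨ y = .pair (.st (M.δ none s)) (.st s)
    | .pair _ (.st c) => y = .pair (.st (M.δ (some c) s)) (.st s)
    | _ => y = .cell (.st s)

/-- The letters `ys` continue a sequence of subconfigurations, up to its end: `win` is the
preceding stretch of letters whose length is that of a subconfiguration, `p` the letter before
`win`, and `s` the phase of the shape checking automaton. -/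
def Walk : M.Phase → M.Letter → List M.Letter → List M.Letter → Prop
  | s, _, win, [] => win.head? = some .boundary ∧ s.Final
  | _, _, [], _ :: _ => False
  | s, p, q :: win, y :: ys =>
    Compat p q y ∧ ∃ s', s.next y = some s' ∧ Walk s' q (win ++ [y]) ys

/-! ## The program -/

/-- The states of the components in which they remember no letter. -/
inductive Ctrl where
  /-- master: initial state -/
  | masterStart
  /-- master: looking for the second boundary symbol -/
  | scan
  /-- master: the computation has been read -/
  | afterDollar
  /-- master: the first block has been read up to its `a` -/
  | afterA
  /-- master: the first block has been read up to its first `b` -/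
  | afterAB
  /-- master: within a block -/
  | block
  /-- master: accepting state -/
  | accept
  /-- halving client: initial state -/
  | halfStart
  /-- halving client: the computation has been read -/
  | arrived
  /-- halving client: waiting for one step after reading an `a` -/
  | half
  /-- halving client: about to read the next symbol of a block -/
  | ready
  /-- halving client: a block has been read up to its first `b` -/
  | blockEnd
  /-- counting client: initial state -/
  | countStart
  /-- counting client: the symbol `$₁` has been read -/
  | countInit
  /-- counting client: one symbol of the computation has been read -/
  | countSkip
  /-- counting client: a symbol has just been read -/
  | fresh
  /-- counting client: a symbol has been read -/
  | waiting
  /-- counting client: the end of the computation has just been read -/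
  | freshEnd
  /-- counting client: the end of the computation has been read -/
  | exhausted
  /-- lagging client: initial state -/
  | lagStart
  /-- lagging client: the symbol `$₁` has been read -/
  | lagWait

variable (M) in
/-- The states of the components. -/
inductive Work where
  | ctrl (c : Ctrl)
  /-- halving client: checking the shape, after the letter `y` -/
  | check (s : M.Phase) (y : M.Letter)
  /-- lagging client: the symbol `[p, q]` has been read -/
  | hold (p q : M.Letter)

open Classical in
/-- The moves of the master. -/
noncomputable def masterMove : M.Work → Reading M.TapeSym → Option (Fin 4 ⊕ M.Work)
  | .ctrl .masterStart, .sym .dollar₁ => some (.inr (.ctrl .scan))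
  | .ctrl .scan, .sym (.comp (_, q)) =>
    some (if q = .boundary then .inl 3 else .inr (.ctrl .scan))
  -- The first reply serves only to reset the lagging client, which reads the first pair during this
  -- move; the second query fetches that pair.
  | .ctrl .lagWait, .eps => some (.inl 3)
  | .hold p q, .sym (.comp (_, y)) => if Compat p q y then some (.inl 3) else none
  -- The next letter would be compared with `q`; a boundary symbol there means that the last
  -- subconfiguration is complete.
  | .hold _ q, .sym .dollar₂ => if q = .boundary then some (.inr (.ctrl .afterDollar)) else none
  | .ctrl .afterDollar, .sym .a => some (.inr (.ctrl .afterA))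
  | .ctrl .afterA, .sym .b => some (.inr (.ctrl .afterAB))
  | .ctrl .afterAB, .sym .b => some (.inl 1)
  | .ctrl .arrived, .sym .a => some (.inr (.ctrl .block))
  | .ctrl .block, .sym .a => some (.inr (.ctrl .block))
  | .ctrl .block, .sym .b => some (.inl 1)
  -- The reply is `blockEnd` only if the halving client has just read the first `b` of its own
  -- block; `half` and `ready` leave the master without a move.
  | .ctrl .blockEnd, .sym .b => some (.inl 2)
  | .ctrl .waiting, .sym .a => some (.inr (.ctrl .block))
  | .ctrl .waiting, .sym .amp => some (.inl 2)
  | .ctrl .freshEnd, .endmark => some (.inr (.ctrl .accept))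
  | _, _ => none

open Classical in
/-- The moves of the halving client. -/
noncomputable def halfMove : M.Work → Reading M.TapeSym → Option M.Work
  | .ctrl .halfStart, .sym .dollar₁ => some (.check .opening .boundary)
  -- The phase `sync` spends the step in which the master makes its empty move, so that both keep
  -- reading the same symbols.
  | .check s y, .eps => s.release.map fun s' => .check s' y
  | .check s y, .sym (.comp (p, q)) =>
    if p = y then (s.next q).map fun s' => .check s' q else none
  | .check s _, .sym .dollar₂ => if s.Final then some (.ctrl .arrived) else none
  | .ctrl .arrived, .eps => some (.ctrl .arrived)
  | .ctrl .halfStart, .sym .a => some (.ctrl .half)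
  | .ctrl .halfStart, .sym .b => some (.ctrl .halfStart)
  -- This extra step makes each `a` cost two time units.
  | .ctrl .half, .eps => some (.ctrl .ready)
  | .ctrl .ready, .sym .a => some (.ctrl .half)
  | .ctrl .ready, .sym .b => some (.ctrl .blockEnd)
  | _, _ => none

/-- The moves of the counting client. -/
def countMove : M.Work → Reading M.TapeSym → Option M.Work
  | .ctrl .countStart, .sym .dollar₁ => some (.ctrl .countInit)
  -- Two pairs are read without any request: one for the first block, which makes no request to this
  -- client, and one for the request at the end of the second block.
  | .ctrl .countInit, .sym (.comp _) => some (.ctrl .countSkip)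
  | .ctrl .countSkip, .sym (.comp _) => some (.ctrl .waiting)
  | .ctrl .countStart, .sym (.comp _) => some (.ctrl .fresh)
  | .ctrl .countStart, .sym .dollar₂ => some (.ctrl .freshEnd)
  -- Keeps the client moving in the last step: after `freshEnd` was sent it stands on the first `a`
  -- while the master accepts.
  | .ctrl .countStart, .sym .a => some (.ctrl .countStart)
  -- The age of the state tells the two kinds of requests apart. The request at `&` comes one step
  -- after the reset and must yield `freshEnd`; a request after a whole block comes later and must
  -- yield `waiting`. The replies `fresh` and `exhausted` block the master.
  | .ctrl .fresh, .eps => some (.ctrl .waiting)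
  | .ctrl .waiting, .eps => some (.ctrl .waiting)
  | .ctrl .freshEnd, .eps => some (.ctrl .exhausted)
  | .ctrl .exhausted, .eps => some (.ctrl .exhausted)
  | _, _ => none

/-- The moves of the lagging client. -/
def lagMove : M.Work → Reading M.TapeSym → Option M.Work
  | .ctrl .lagStart, .sym .dollar₁ => some (.ctrl .lagWait)
  | .ctrl .lagStart, .sym (.comp (p, q)) => some (.hold p q)
  | .ctrl .lagWait, .eps => some (.ctrl .lagWait)
  | .hold p q, .eps => some (.hold p q)
  | _, _ => none

variable (M) in
/-- The program that accepts the padded valid computations. -/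
noncomputable def valcProgram : Program M.TapeSym M.Work where
  master := masterMove
  client₁ := halfMove
  client₂ := countMove
  client₃ := lagMove
  start₀ := .ctrl .masterStart
  start₁ := .ctrl .halfStart
  start₂ := .ctrl .countStart
  start₃ := .ctrl .lagStart
  accept := .ctrl .accept
  accept_halts _ := rfl
  master_eps := by
    rintro (c | _ | _) h r hr
    · cases c <;> first | exact absurd rfl h | (cases r <;> first | rfl | exact absurd rfl hr)
    all_goals exact absurd rfl h
  client₁_eps := by
    rintro (c | ⟨s, y⟩ | _) h r hr
    · cases c <;> first | exact absurd rfl h | (cases r <;> first | rfl | exact absurd rfl hr)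
    · have hs : s.release ≠ none := by
        rintro hs
        simp [halfMove, hs] at h
      rcases r with (_ | _ | _ | _ | _ | ⟨p, q⟩) | _ | _
      all_goals
        simp [halfMove, Phase.next_of_release hs, Phase.not_final_of_release hs] at hr ⊢
    · exact absurd rfl h
  client₂_eps := by
    rintro (c | _ | _) h r hr
    · cases c <;> first | exact absurd rfl h | (cases r <;> first | rfl | exact absurd rfl hr)
    all_goals exact absurd rfl h
  client₃_eps := by
    rintro (c | _ | _) h r hr
    · cases c <;> first | exact absurd rfl h | (cases r <;> first | rfl | exact absurd rfl hr)
    · exact absurd rfl h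
    · cases r <;> first | rfl | exact absurd rfl hr

/-! ## Finiteness -/

instance : Finite M.State := M.state_finite

instance : Finite M.CellSym :=
  Finite.of_surjective (Sum.elim CellSym.st CellSym.primed) <| by
    rintro (s | t)
    exacts [⟨.inl s, rfl⟩, ⟨.inr t, rfl⟩]

instance : Finite M.Letter :=
  Finite.of_surjective (fun o : Option (M.CellSym ⊕ M.CellSym × M.CellSym) =>
    o.elim Letter.boundary (Sum.elim Letter.cell fun p => Letter.pair p.1 p.2)) <| by
    rintro (_ | p | ⟨p, q⟩)
    exacts [⟨none, rfl⟩, ⟨some (.inl p), rfl⟩, ⟨some (.inr (p, q)), rfl⟩]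

instance : Finite M.TapeSym :=
  Finite.of_surjective (Sum.elim (![TapeSym.a, .b, .dollar₁, .dollar₂, .amp] : Fin 5 → M.TapeSym)
    TapeSym.comp) <| by
    rintro (_ | _ | _ | _ | _ | p)
    exacts [⟨.inl 0, rfl⟩, ⟨.inl 1, rfl⟩, ⟨.inl 2, rfl⟩, ⟨.inl 3, rfl⟩, ⟨.inl 4, rfl⟩,
      ⟨.inr p, rfl⟩]

instance : Finite Ctrl :=
  Finite.of_surjective (![.masterStart, .scan, .afterDollar, .afterA, .afterAB, .block, .accept, .halfStart,
    .arrived, .half, .ready, .blockEnd, .countStart, .countInit, .countSkip, .fresh, .waiting,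
    .freshEnd, .exhausted, .lagStart, .lagWait] : Fin 21 → Ctrl) <| by
    rintro ⟨⟩
    exacts [⟨0, rfl⟩, ⟨1, rfl⟩, ⟨2, rfl⟩, ⟨3, rfl⟩, ⟨4, rfl⟩, ⟨5, rfl⟩, ⟨6, rfl⟩, ⟨7, rfl⟩, ⟨8, rfl⟩,
      ⟨9, rfl⟩, ⟨10, rfl⟩, ⟨11, rfl⟩, ⟨12, rfl⟩, ⟨13, rfl⟩, ⟨14, rfl⟩, ⟨15, rfl⟩, ⟨16, rfl⟩,
      ⟨17, rfl⟩, ⟨18, rfl⟩, ⟨19, rfl⟩, ⟨20, rfl⟩]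

instance : Finite M.Phase :=
  Finite.of_surjective (Sum.elim (![Phase.opening, .input, .sync] : Fin 3 → M.Phase)
    (Sum.elim (fun p : M.State × Fin 4 => Phase.just p.1 p.2)
      fun p : Fin 4 × Fin 4 => (![Phase.first, .lead₀, .lead, .trail] : Fin 4 → _) p.1 p.2)) <| by
    rintro (_ | _ | _ | k | k | k | ⟨d, k⟩ | k)
    exacts [⟨.inl 0, rfl⟩, ⟨.inl 1, rfl⟩, ⟨.inl 2, rfl⟩, ⟨.inr (.inr (0, k)), rfl⟩,
      ⟨.inr (.inr (1, k)), rfl⟩, ⟨.inr (.inr (2, k)), rfl⟩, ⟨.inr (.inl (d, k)), rfl⟩,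
      ⟨.inr (.inr (3, k)), rfl⟩]

instance : Finite M.Work :=
  Finite.of_surjective (Sum.elim Work.ctrl
    (Sum.elim (fun p : M.Phase × M.Letter => Work.check p.1 p.2)
      fun p : M.Letter × M.Letter => Work.hold p.1 p.2)) <| by
    rintro (c | ⟨s, y⟩ | ⟨p, q⟩)
    exacts [⟨.inl c, rfl⟩, ⟨.inr (.inl (s, y)), rfl⟩, ⟨.inr (.inr (p, q)), rfl⟩]


/-! ## The blocks -/

/-- `n` blocks, each of them twice as long as its predecessor, after a block of length `k`. -/
def blocksAfter (k : ℕ) : ℕ → List M.TapeSym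
  | 0 => [.amp]
  | n + 1 => List.replicate (2 * k) .a ++ .b :: .b :: blocksAfter (2 * k) n

theorem blocksAfter_eq (i n : ℕ) : blocksAfter (M := M) (2 ^ i) n =
    (List.range n).flatMap
      (fun j => List.replicate (2 ^ (i + 1 + j)) TapeSym.a ++ [TapeSym.b, TapeSym.b]) ++ [.amp] := by
  induction n generalizing i with
  | zero => rfl
  | succ n ih =>
    rw [blocksAfter, ← pow_succ', ih, List.range_succ_eq_map, List.flatMap_cons, List.flatMap_map]
    simp [add_comm, add_left_comm]

theorem doublingBlocks_succ (n : ℕ) : M.doublingBlocks (n + 1) ++ [TapeSym.amp] =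
    .a :: .b :: .b :: blocksAfter 1 n := by
  have h := blocksAfter_eq (M := M) 0 n
  rw [pow_zero] at h
  rw [h, doublingBlocks, List.range_succ_eq_map, List.flatMap_cons, List.flatMap_map]
  simp [add_comm]

/-- While the master reads a block of length `2 * j + 2`, the halving client reads the preceding
block of length `j + 1`. -/
theorem block_inv {p q : M.Letter} {u rc re : List M.TapeSym} (j : ℕ) :
    ∀ {sC sC' : M.Work} {t : List M.TapeSym} {n : ℕ}, countMove sC .eps = some sC' →
    countMove sC' .eps = some sC' →
    (valcProgram M).Accepts ⟨.inr (.ctrl .block), .ctrl .half, sC, .hold p q, t,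
      List.replicate j .a ++ .b :: .b :: u, rc, re⟩ n →
    ∃ t' n', t = List.replicate (2 * j + 1) .a ++ .b :: .b :: t' ∧
      (valcProgram M).Accepts ⟨.inr sC', .ctrl .halfStart, .ctrl .countStart, .hold p q, t', u,
        rc, re⟩ n' := by
  induction j with
  | zero =>
    intro sC sC' t n hC hC' h
    have mC : ∀ rc, move (valcProgram M).client₂ sC rc = some (sC', rc) := fun rc => by
      simp [move, valcProgram, hC]
    have mC' : ∀ rc, move (valcProgram M).client₂ sC' rc = some (sC', rc) := fun rc => by
      simp [move, valcProgram, hC']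
    obtain ⟨m', t', h₀, h⟩ := h.work_det nofun rfl (mC _) rfl
    rcases t with _ | ⟨_ | _ | _ | _ | _ | _, t⟩ <;> cases h₀
    · obtain ⟨m', t', h₀, h⟩ := h.work_det nofun rfl (mC' _) rfl
      rcases t with _ | ⟨_ | _ | _ | _ | _ | _, t⟩ <;> cases h₀
      -- The master's block is too long: in `blockEnd` the halving client has no move.
      · obtain ⟨_, _, _, _, _, _, _, _, -, h₁, -⟩ := h.work_inv nofun
        cases h₁
      · obtain ⟨n', h⟩ := h.ask₁_inv
        obtain ⟨m', t', h₀, h⟩ := h.work_det nofun rfl (mC' _) rfl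
        rcases t with _ | ⟨_ | _ | _ | _ | _ | _, t⟩ <;> cases h₀
        obtain ⟨n'', h⟩ := h.ask₂_inv
        exact ⟨_, _, rfl, h⟩
    -- The master's block is too short: the reply is `ready`, from which the master has no move.
    · obtain ⟨n', h⟩ := h.ask₁_inv
      obtain ⟨_, _, _, _, _, _, _, _, h₀, -⟩ := h.work_inv nofun
      rcases t with _ | ⟨_ | _ | _ | _ | _ | _, t⟩ <;> cases h₀
  | succ j ih =>
    intro sC sC' t n hC hC' h
    have mC : ∀ rc, move (valcProgram M).client₂ sC rc = some (sC', rc) := fun rc => by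
      simp [move, valcProgram, hC]
    have mC' : ∀ rc, move (valcProgram M).client₂ sC' rc = some (sC', rc) := fun rc => by
      simp [move, valcProgram, hC']
    obtain ⟨m', t', h₀, h⟩ := h.work_det nofun rfl (mC _) rfl
    rcases t with _ | ⟨_ | _ | _ | _ | _ | _, t⟩ <;> cases h₀
    · obtain ⟨m', t', h₀, h⟩ := h.work_det nofun rfl (mC' _) rfl
      rcases t with _ | ⟨_ | _ | _ | _ | _ | _, t⟩ <;> cases h₀
      · obtain ⟨t', n', rfl, h'⟩ := ih hC' hC' h
        exact ⟨t', n', rfl, h'⟩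
      · obtain ⟨n', h⟩ := h.ask₁_inv
        obtain ⟨_, _, _, _, _, _, _, _, h₀, -⟩ := h.work_inv nofun
        rcases t with _ | ⟨_ | _ | _ | _ | _ | _, t⟩ <;> cases h₀
    · obtain ⟨n', h⟩ := h.ask₁_inv
      obtain ⟨_, _, _, _, _, _, _, _, h₀, -⟩ := h.work_inv nofun
      rcases t with _ | ⟨_ | _ | _ | _ | _ | _, t⟩ <;> cases h₀

/-- Each block costs two queries, one to the halving and one to the counting client. The state `sC`
stands for `waiting`, `fresh` or `freshEnd`, each of which settles after one empty move. -/
theorem block_accepts {p q : M.Letter} {u rc re : List M.TapeSym} (j : ℕ) :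
    ∀ {sC sC' : M.Work} {t : List M.TapeSym} {n : ℕ}, countMove sC .eps = some sC' →
    countMove sC' .eps = some sC' →
    (valcProgram M).Accepts ⟨.inr sC', .ctrl .halfStart, .ctrl .countStart, .hold p q, t, u,
      rc, re⟩ n →
    (valcProgram M).Accepts ⟨.inr (.ctrl .block), .ctrl .half, sC, .hold p q,
      List.replicate (2 * j + 1) .a ++ .b :: .b :: t,
      List.replicate j .a ++ .b :: .b :: u, rc, re⟩ (n + 2) := by
  induction j with
  | zero =>
    intro sC sC' t n hC hC' h
    have mC : ∀ rc, move (valcProgram M).client₂ sC rc = some (sC', rc) := fun rc => by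
      simp [move, valcProgram, hC]
    have mC' : ∀ rc, move (valcProgram M).client₂ sC' rc = some (sC', rc) := fun rc => by
      simp [move, valcProgram, hC']
    exact .of_work rfl rfl (mC _) rfl (.of_work rfl rfl (mC' _) rfl (.ask₁ _ _ _ _ _ _ _ _
      (.of_work rfl rfl (mC' _) rfl (.ask₂ _ _ _ _ _ _ _ _ h))))
  | succ j ih =>
    intro sC sC' t n hC hC' h
    have mC : ∀ rc, move (valcProgram M).client₂ sC rc = some (sC', rc) := fun rc => by
      simp [move, valcProgram, hC]
    have mC' : ∀ rc, move (valcProgram M).client₂ sC' rc = some (sC', rc) := fun rc => by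
      simp [move, valcProgram, hC']
    exact .of_work rfl rfl (mC _) rfl (.of_work rfl rfl (mC' _) rfl (ih hC' hC' h))

/-- The remaining blocks are correct and as many as the remaining symbols of the computation. -/
theorem blocks_inv {p q : M.Letter} {rest re : List M.TapeSym} (l : List (M.Letter × M.Letter)) :
    ∀ {k : ℕ} {t : List M.TapeSym} {n : ℕ},
    (valcProgram M).Accepts ⟨.inr (.ctrl .waiting), .ctrl .halfStart, .ctrl .countStart,
      .hold p q, t, List.replicate (k + 1) .a ++ .b :: .b :: t,
      l.map .comp ++ .dollar₂ :: rest, re⟩ n →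
    t = blocksAfter (k + 1) l.length := by
  induction l with
  | nil =>
    intro k t n h
    obtain ⟨m', t', h₀, h⟩ := h.work_det nofun rfl rfl rfl
    rcases t with _ | ⟨_ | _ | _ | _ | _ | _, t⟩ <;> cases h₀
    -- A block too many: the counting client answers `exhausted`.
    · obtain ⟨t', n', -, h⟩ := block_inv k rfl rfl h
      obtain ⟨_, _, _, _, _, _, _, _, h₀, -⟩ := h.work_inv nofun
      rcases t' with _ | ⟨_ | _ | _ | _ | _ | _, t'⟩ <;> cases h₀
    · obtain ⟨n', h⟩ := h.ask₂_inv
      obtain ⟨_, _, _, _, _, _, _, _, h₀, -⟩ := h.work_inv nofun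
      rcases t with _ | ⟨_ | _ | _ | _ | _ | _, t⟩ <;> cases h₀
      rfl
  | cons x l ih =>
    intro k t n h
    obtain ⟨m', t', h₀, h⟩ := h.work_det nofun rfl rfl rfl
    rcases t with _ | ⟨_ | _ | _ | _ | _ | _, t⟩ <;> cases h₀
    · obtain ⟨t', n', rfl, h⟩ := block_inv k rfl rfl h
      -- Block lengths are kept as successors: 2 * (k + 1) = (2 * k + 1) + 1.
      rw [ih (k := 2 * k + 1) h]
      rfl
    -- A block too few: at `&` the counting client answers `fresh`.
    · obtain ⟨n', h⟩ := h.ask₂_inv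
      obtain ⟨_, _, _, _, _, _, _, _, h₀, -⟩ := h.work_inv nofun
      rcases t with _ | ⟨_ | _ | _ | _ | _ | _, t⟩ <;> cases h₀

/-- Two queries for each remaining block and one at `&`. The `a` behind `$₂` lets the counting
client move in the last step. -/
theorem blocks_accepts {p q : M.Letter} {rest re : List M.TapeSym}
    (l : List (M.Letter × M.Letter)) : ∀ {k : ℕ},
    (valcProgram M).Accepts ⟨.inr (.ctrl .waiting), .ctrl .halfStart, .ctrl .countStart,
      .hold p q, blocksAfter (k + 1) l.length,
      List.replicate (k + 1) .a ++ .b :: .b :: blocksAfter (k + 1) l.length,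
      l.map .comp ++ .dollar₂ :: .a :: rest, re⟩ (2 * l.length + 1) := by
  induction l with
  | nil =>
    intro k
    exact .of_work rfl rfl rfl rfl (.ask₂ _ _ _ _ _ _ _ _
      (.of_work rfl rfl rfl rfl (.done _ _ _ _ _ _ _ _ rfl)))
  | cons x l ih =>
    intro k
    exact .of_work rfl rfl rfl rfl (block_accepts k rfl rfl (ih (k := 2 * k + 1)))

/-- The part of the word after the symbol `$₂`. -/
theorem afterDollar_inv {p q : M.Letter} {t rest re : List M.TapeSym}
    {l : List (M.Letter × M.Letter)} {n : ℕ}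
    (h : (valcProgram M).Accepts ⟨.inr (.ctrl .afterDollar), .ctrl .arrived, .ctrl .waiting,
      .hold p q, t, t, l.map .comp ++ .dollar₂ :: rest, re⟩ n) :
    t = .a :: .b :: .b :: blocksAfter 1 (l.length + 1) := by
  obtain ⟨m', t', h₀, h⟩ := h.work_det nofun rfl rfl rfl
  rcases t with _ | ⟨_ | _ | _ | _ | _ | _, t⟩ <;> cases h₀
  obtain ⟨m', t', h₀, h⟩ := h.work_det nofun rfl rfl rfl
  rcases t with _ | ⟨_ | _ | _ | _ | _ | _, t⟩ <;> cases h₀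
  obtain ⟨m', t', h₀, h⟩ := h.work_det nofun rfl rfl rfl
  rcases t with _ | ⟨_ | _ | _ | _ | _ | _, t⟩ <;> cases h₀
  obtain ⟨n', h⟩ := h.ask₁_inv
  obtain ⟨m', t', h₀, h⟩ := h.work_det nofun rfl rfl rfl
  rcases t with _ | ⟨_ | _ | _ | _ | _ | _, t⟩ <;> cases h₀
  obtain ⟨t', n', rfl, h⟩ := block_inv 0 rfl rfl h
  rw [blocks_inv (k := 1) l h]
  rfl

/-- One query fetches `arrived`, two belong to the second block, and `blocks_accepts` needs 2 *
l.length + 1. The list `l` lacks the first two pairs. -/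
theorem afterDollar_accepts {p q : M.Letter} {rest re : List M.TapeSym}
    {l : List (M.Letter × M.Letter)} :
    (valcProgram M).Accepts ⟨.inr (.ctrl .afterDollar), .ctrl .arrived, .ctrl .waiting,
      .hold p q, .a :: .b :: .b :: blocksAfter 1 (l.length + 1),
      .a :: .b :: .b :: blocksAfter 1 (l.length + 1),
      l.map .comp ++ .dollar₂ :: .a :: rest, re⟩ (2 * l.length + 4) :=
  .of_work rfl rfl rfl rfl (.of_work rfl rfl rfl rfl (.of_work rfl rfl rfl rfl
    (.ask₁ _ _ _ _ _ _ _ _ (.of_work rfl rfl rfl rfl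
      (block_accepts 0 rfl rfl (blocks_accepts (k := 1) l))))))

/-! ## The computation -/

/-- The tape that encodes the letters `y, y₁, y₂, …` by pairs. -/
def pairTape (y : M.Letter) : List M.Letter → List M.TapeSym
  | [] => []
  | z :: zs => .comp (y, z) :: pairTape z zs

theorem map_pairUp_cons (y : M.Letter) (ys : List M.Letter) :
    (pairUp (y :: ys)).map TapeSym.comp = pairTape y ys := by
  induction ys generalizing y with
  | nil => rfl
  | cons z zs ih => exact congrArg (TapeSym.comp (y, z) :: ·) (ih z)

theorem pairTape_append (y : M.Letter) (u v : List M.Letter) :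
    pairTape y (u ++ v) = pairTape y u ++ pairTape ((y :: u).getLast (by simp)) v := by
  induction u generalizing y with
  | nil => rfl
  | cons z zs ih =>
    simp only [List.cons_append, pairTape, ih]
    simp

/-- The window slides by one letter: the pair just read by the master joins the stretch that lies
ahead of the lagging client. -/
theorem pairTape_cons_concat (w w' y : M.Letter) (win : List M.Letter) (t : List M.TapeSym) :
    pairTape w (w' :: (win ++ [y])) ++ t =
      pairTape w (w' :: win) ++ .comp ((w :: w' :: win).getLast (by simp), y) :: t := by
  rw [← List.cons_append, pairTape_append]
  simp [pairTape]

theorem move_check {s : M.Phase} (hs : s.Late) {y : M.Letter} {x : List M.TapeSym} :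
    move (valcProgram M).client₁ (.check s y) x =
      (halfMove (.check s y) (scanned x)).map fun p => (p, x.tail) := by
  simp [move, valcProgram, halfMove, hs.release_eq]

/-- The master compares the letters with those in the preceding subconfiguration. -/
theorem walk_inv {rc : List M.TapeSym} (t : List M.TapeSym) :
    ∀ {s : M.Phase} {p q w : M.Letter} {win : List M.Letter} {n : ℕ}, s.Late →
    (valcProgram M).Accepts ⟨.inr (.hold p q), .check s ((w :: win).getLast (by simp)),
      .ctrl .waiting, .ctrl .lagStart, t, t, rc, pairTape q (w :: win) ++ t⟩ n →
    ∃ ys rest p' q' re n', t = pairTape ((w :: win).getLast (by simp)) ys ++ .dollar₂ :: rest ∧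
      Walk s p (q :: w :: win) ys ∧
      (valcProgram M).Accepts ⟨.inr (.ctrl .afterDollar), .ctrl .arrived, .ctrl .waiting,
        .hold p' q', rest, rest, rc, re⟩ n' := by
  induction t with
  | nil =>
    intro s p q w win n hs h
    obtain ⟨_, _, _, _, _, _, _, _, h₀, -⟩ := h.work_inv nofun
    cases h₀
  | cons x t ih =>
    intro s p q w win n hs h
    obtain ⟨_, _, _, _, _, _, _, _, h₀, h₁, h₂, h₃, h⟩ := h.work_inv nofun
    rw [move_check hs] at h₁
    cases h₂
    cases h₃
    rcases x with _ | _ | _ | _ | _ | ⟨p', y⟩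
    · cases h₀
    · cases h₀
    · cases h₀
    · simp only [valcProgram, move, masterMove, scanned, halfMove] at h₀ h₁
      split_ifs at h₀ with hq
      swap
      · cases h₀
      split_ifs at h₁ with hf
      swap
      · cases h₁
      cases h₀
      cases h₁
      exact ⟨[], t, _, _, _, n, rfl, ⟨by simp [hq], hf⟩, h⟩
    · cases h₀
    · simp only [valcProgram, move, masterMove, scanned, halfMove] at h₀ h₁
      split_ifs at h₀ with hq
      swap
      · cases h₀
      split_ifs at h₁ with hp
      swap
      · cases h₁
      cases h₀
      simp only [Option.map_map, Option.map_eq_some_iff, Function.comp_apply, Prod.mk.injEq] at h₁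
      obtain ⟨s', hs', rfl, rfl⟩ := h₁
      obtain ⟨n', h⟩ := h.ask₃_inv
      subst hp
      rcases win with _ | ⟨w', win⟩
      · obtain ⟨ys, rest, p', q', re, n', rfl, hw, h⟩ :=
          ih (w := y) (win := []) (hs.next hs') h
        exact ⟨y :: ys, rest, p', q', re, n', rfl, ⟨hq, s', hs', hw⟩, h⟩
      · have e' : (w' :: (win ++ [y])).getLast (by simp) = y := by simp
        obtain ⟨ys, rest, p', q', re, n', rfl, hw, h⟩ :=
          ih (w := w') (win := win ++ [y]) (p := q) (q := w) (n := n') (hs.next hs') (by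
            rw [e', pairTape_cons_concat]
            exact h)
        rw [e']
        exact ⟨y :: ys, rest, p', q', re, n', rfl, ⟨hq, s', hs', hw⟩, h⟩

/-- One query per letter, because after each comparison the master asks for the next lagging pair.
-/
theorem walk_accepts {rc rest : List M.TapeSym} {n : ℕ}
    (h : ∀ p q re, (valcProgram M).Accepts ⟨.inr (.ctrl .afterDollar), .ctrl .arrived,
      .ctrl .waiting, .hold p q, rest, rest, rc, re⟩ n) (ys : List M.Letter) :
    ∀ {s : M.Phase} {p q w : M.Letter} {win : List M.Letter}, s.Late →
    Walk s p (q :: w :: win) ys →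
    (valcProgram M).Accepts ⟨.inr (.hold p q), .check s ((w :: win).getLast (by simp)),
      .ctrl .waiting, .ctrl .lagStart,
      pairTape ((w :: win).getLast (by simp)) ys ++ .dollar₂ :: rest,
      pairTape ((w :: win).getLast (by simp)) ys ++ .dollar₂ :: rest, rc,
      pairTape q (w :: win) ++ (pairTape ((w :: win).getLast (by simp)) ys ++ .dollar₂ :: rest)⟩
      (n + ys.length) := by
  induction ys with
  | nil =>
    rintro s p q w win hs ⟨hq, hf⟩
    refine .of_work ?_ ?_ rfl rfl (h q w _)
    · have : q = .boundary := by simpa using hq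
      simp [move, valcProgram, masterMove, pairTape, scanned, this]
    · rw [move_check hs]
      simp [halfMove, pairTape, scanned, hf]
  | cons y ys ih =>
    rintro s p q w win hs ⟨hq, s', hs', hw⟩
    refine .of_work (m' := .inl 3) (s₁' := .check s' y) (s₃' := .hold q w)
      (r₀' := pairTape y ys ++ .dollar₂ :: rest) (r₁' := pairTape y ys ++ .dollar₂ :: rest)
      ?_ ?_ rfl rfl (.ask₃ _ _ _ _ _ _ _ (n + ys.length) ?_)
    · simp [move, valcProgram, masterMove, pairTape, scanned, hq]
    · rw [move_check hs]
      simp [halfMove, pairTape, scanned, hs']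
    · rcases win with _ | ⟨w', win⟩
      · exact ih (w := y) (win := []) (hs.next hs') hw
      · have h' := ih (w := w') (win := win ++ [y]) (hs.next hs') hw
        have e' : (w' :: (win ++ [y])).getLast (by simp) = y := by simp
        rw [e', pairTape_cons_concat] at h'
        exact h'

/-- The letter of an input symbol in the initial configuration. -/
def inputLetter (t : M.T) : M.Letter := .cell (.primed t)

theorem next_input_eq_some {y : M.Letter} {s : M.Phase} (h : Phase.input.next y = some s) :
    (∃ t, y = inputLetter t ∧ s = .input) ∨ (y = .boundary ∧ s = .sync) := by
  rcases y with _ | (_ | t) | _ <;> cases h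
  exacts [.inr ⟨rfl, rfl⟩, .inl ⟨t, rfl, rfl⟩]

theorem next_opening_eq_some {y : M.Letter} {s : M.Phase} (h : Phase.opening.next y = some s) :
    ∃ t, y = inputLetter t ∧ s = .input := by
  rcases y with _ | (_ | t) | _ <;> cases h
  exact ⟨t, rfl, rfl⟩

theorem move_check_comp {s : M.Phase} (hs : s.release = none) {y p q : M.Letter}
    {t r : List M.TapeSym} {s₁ : M.Work}
    (h : move (valcProgram M).client₁ (.check s y) (.comp (p, q) :: t) = some (s₁, r)) :
    p = y ∧ r = t ∧ ∃ s', s.next q = some s' ∧ s₁ = .check s' q := by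
  simp only [valcProgram, move, halfMove, hs, scanned, Option.map_none] at h
  split_ifs at h with hp
  swap
  · cases h
  simp only [Option.map_map, Option.map_eq_some_iff, Function.comp_apply, Prod.mk.injEq] at h
  obtain ⟨s', hs', rfl, rfl⟩ := h
  exact ⟨hp, rfl, s', hs', rfl⟩

theorem move_check_of_next {s s' : M.Phase} {y q : M.Letter} (h : s.next q = some s')
    (t : List M.TapeSym) :
    move (valcProgram M).client₁ (.check s y) (.comp (y, q) :: t) = some (.check s' q, t) := by
  have hs : s.release = none := by
    by_contra hs
    simp [Phase.next_of_release hs] at h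
  simp [move, valcProgram, halfMove, scanned, hs, h]

theorem move_scan_inputLetter (p : M.Letter) (t : M.T) (r : List M.TapeSym) :
    move (valcProgram M).master (.ctrl .scan) (.comp (p, inputLetter t) :: r) =
      some (.inr (.ctrl .scan), r) := by
  simp [move, valcProgram, masterMove, scanned, inputLetter]

theorem move_scan_boundary (p : M.Letter) (r : List M.TapeSym) :
    move (valcProgram M).master (.ctrl .scan) (.comp (p, .boundary) :: r) = some (.inl 3, r) := by
  simp [move, valcProgram, masterMove, scanned]

/-- The master looks for the end of the initial configuration. -/
theorem scan_inv {re : List M.TapeSym} (t : List M.TapeSym) :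
    ∀ {y : M.Letter} {rc : List M.TapeSym} {n : ℕ},
    (valcProgram M).Accepts ⟨.inr (.ctrl .scan), .check .input y,
      .ctrl .waiting, .ctrl .lagWait, t, t, rc, re⟩ n →
    ∃ (ts : List M.T) (rest : List M.TapeSym) (n' : ℕ),
      t = pairTape y (ts.map inputLetter ++ [.boundary]) ++ rest ∧
      (valcProgram M).Accepts ⟨.inl 3, .check .sync .boundary, .ctrl .waiting, .ctrl .lagWait,
        rest, rest, rc, re⟩ n' := by
  induction t with
  | nil =>
    intro y rc n h
    obtain ⟨_, _, _, _, _, _, _, _, h₀, -⟩ := h.work_inv nofun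
    cases h₀
  | cons x t ih =>
    intro y rc n h
    obtain ⟨_, _, _, _, _, _, _, _, h₀, h₁, h₂, h₃, h⟩ := h.work_inv nofun
    rcases x with _ | _ | _ | _ | _ | ⟨p, q⟩ <;> cases h₀
    cases h₂
    cases h₃
    obtain ⟨rfl, rfl, s', hs', rfl⟩ := move_check_comp rfl h₁
    rcases next_input_eq_some hs' with ⟨t', rfl, rfl⟩ | ⟨rfl, rfl⟩
    · rw [if_neg nofun] at h
      obtain ⟨ts, rest, n', rfl, h'⟩ := ih h
      exact ⟨t' :: ts, rest, n', rfl, h'⟩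
    · rw [if_pos rfl] at h
      exact ⟨[], _, n, rfl, h⟩

theorem scan_accepts {re rest rc : List M.TapeSym} {n : ℕ}
    (h : (valcProgram M).Accepts ⟨.inl 3, .check .sync .boundary, .ctrl .waiting, .ctrl .lagWait,
        rest, rest, rc, re⟩ n) (ts : List M.T) : ∀ {y : M.Letter},
    (valcProgram M).Accepts ⟨.inr (.ctrl .scan), .check .input y,
      .ctrl .waiting, .ctrl .lagWait, pairTape y (ts.map inputLetter ++ [.boundary]) ++ rest,
      pairTape y (ts.map inputLetter ++ [.boundary]) ++ rest, rc, re⟩ n := by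
  induction ts with
  | nil =>
    intro y
    exact .of_work (move_scan_boundary _ _) (move_check_of_next rfl _) rfl rfl h
  | cons t ts ih =>
    intro y
    exact .of_work (move_scan_inputLetter _ _ _) (move_check_of_next rfl _) rfl rfl ih

/-- The word that encodes the boundary symbol followed by the letters `v`. -/
def padded (v : List M.Letter) : List M.TapeSym :=
  .dollar₁ :: (pairTape .boundary v ++ .dollar₂ :: (M.doublingBlocks v.length ++ [.amp]))

theorem pairTape_eq_map (y : M.Letter) (v : List M.Letter) :
    ∃ l : List (M.Letter × M.Letter), pairTape y v = l.map .comp ∧ l.length = v.length := by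
  induction v generalizing y with
  | nil => exact ⟨[], rfl, rfl⟩
  | cons z v ih =>
    obtain ⟨l, h, hl⟩ := ih z
    exact ⟨(y, z) :: l, by rw [pairTape, h, List.map_cons], by simp [hl]⟩

/-- After the primed input has been read. -/
theorem sync_inv {t : M.T} {ts : List M.T} {rest : List M.TapeSym} {n : ℕ}
    {rc : List M.TapeSym}
    (h : (valcProgram M).Accepts ⟨.inl 3, .check .sync .boundary, .ctrl .waiting, .ctrl .lagWait,
      rest, rest, rc,
      pairTape .boundary ((t :: ts).map inputLetter ++ [.boundary]) ++ rest⟩ n) :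
    ∃ ys rest' p q re n', rest = pairTape .boundary ys ++ .dollar₂ :: rest' ∧
      Walk (.first 0) .boundary ((t :: ts).map inputLetter ++ [.boundary]) ys ∧
      (valcProgram M).Accepts ⟨.inr (.ctrl .afterDollar), .ctrl .arrived, .ctrl .waiting,
        .hold p q, rest', rest', rc, re⟩ n' := by
  obtain ⟨n', h⟩ := h.ask₃_inv
  obtain ⟨_, _, h₀, h⟩ := h.work_det (s₁' := .check (.first 0) .boundary) nofun rfl rfl rfl
  cases h₀
  obtain ⟨n', h⟩ := h.ask₃_inv
  rcases ts with _ | ⟨t', ts⟩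
  · exact walk_inv (w := .boundary) (win := []) rest trivial h
  · have := walk_inv (w := inputLetter t') (win := ts.map inputLetter ++ [.boundary])
      (s := .first 0) (p := .boundary) (q := inputLetter t) (n := n') (rc := rc) rest trivial
    have e : (inputLetter t' :: (ts.map inputLetter ++ [Letter.boundary])).getLast (by simp) =
      Letter.boundary := by simp
    rw [e] at this
    exact this h

/-- The two additional queries are the one that resets the lagging client and the one that fetches
its first pair. -/
theorem sync_accepts {t : M.T} {ts : List M.T} {rest rc : List M.TapeSym} {n : ℕ}
    {ys : List M.Letter}
    (hw : Walk (.first 0) .boundary ((t :: ts).map inputLetter ++ [.boundary]) ys)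
    (h : ∀ p q re, (valcProgram M).Accepts ⟨.inr (.ctrl .afterDollar), .ctrl .arrived,
      .ctrl .waiting, .hold p q, rest, rest, rc, re⟩ n) :
    (valcProgram M).Accepts ⟨.inl 3, .check .sync .boundary, .ctrl .waiting, .ctrl .lagWait,
      pairTape .boundary ys ++ .dollar₂ :: rest, pairTape .boundary ys ++ .dollar₂ :: rest, rc,
      pairTape .boundary ((t :: ts).map inputLetter ++ [.boundary]) ++
        (pairTape .boundary ys ++ .dollar₂ :: rest)⟩ (n + ys.length + 2) := by
  refine .ask₃ _ _ _ _ _ _ _ _ (.of_work (s₁' := .check (.first 0) .boundary) rfl rfl rfl rfl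
    (.ask₃ _ _ _ _ _ _ _ _ ?_))
  rcases ts with _ | ⟨t', ts⟩
  · exact walk_accepts h ys (w := .boundary) (win := []) trivial hw
  · have h' := walk_accepts h ys (w := inputLetter t')
      (win := ts.map inputLetter ++ [.boundary]) (s := .first 0) (p := .boundary)
      (q := inputLetter t) trivial (by simpa using hw)
    have e : (inputLetter t' :: (ts.map inputLetter ++ [Letter.boundary])).getLast (by simp) =
      Letter.boundary := by simp
    rw [e] at h'
    exact h'

/-! ### The whole run -/

theorem pairTape_append_boundary (y : M.Letter) (u ys : List M.Letter) (r : List M.TapeSym) :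
    pairTape y (u ++ [.boundary]) ++ (pairTape .boundary ys ++ r) =
      pairTape y (u ++ .boundary :: ys) ++ r := by
  have h : u ++ .boundary :: ys = (u ++ [.boundary]) ++ ys := by simp
  rw [h, pairTape_append y (u ++ _)]
  simp

/-- The first three steps are unfolded by hand, since there the phase `opening` and the start of the
counting client matter; from then on the inversion lemmas of the stages apply. -/
theorem exists_of_accepts {w : List M.TapeSym} {n : ℕ}
    (h : (valcProgram M).Accepts ((valcProgram M).initialRun w) n) :
    ∃ t ts ys, w = padded ((t :: ts).map inputLetter ++ .boundary :: ys) ∧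
      Walk (.first 0) .boundary ((t :: ts).map inputLetter ++ [.boundary]) ys := by
  obtain ⟨_, _, _, _, _, _, _, _, h₀, h₁, h₂, h₃, h⟩ := h.work_inv nofun
  rcases w with _ | ⟨_ | _ | _ | _ | _ | _, w⟩ <;> cases h₀
  cases h₁
  cases h₂
  cases h₃
  obtain ⟨_, _, _, _, _, _, _, _, h₀, h₁, h₂, h₃, h⟩ := h.work_inv nofun
  rcases w with _ | ⟨_ | _ | _ | _ | _ | ⟨p, q⟩, w⟩ <;> cases h₀
  cases h₂
  cases h₃
  obtain ⟨rfl, hr, s', hs', rfl⟩ := move_check_comp rfl h₁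
  rw [hr] at h
  obtain ⟨t, rfl, rfl⟩ := next_opening_eq_some hs'
  rw [if_neg nofun] at h
  clear h₁
  obtain ⟨_, _, _, _, _, _, _, _, h₀, h₁, h₂, h₃, h⟩ := h.work_inv nofun
  rcases w with _ | ⟨_ | _ | _ | _ | _ | ⟨p, q⟩, w⟩ <;> cases h₀
  cases h₂
  cases h₃
  obtain ⟨rfl, hr, s', hs', rfl⟩ := move_check_comp rfl h₁
  rw [hr] at h
  -- The second pair already contains the second boundary symbol if there is only one cell;
  -- otherwise the scan goes on.
  have key : ∃ (ts : List M.T) (rest : List M.TapeSym) (n' : ℕ),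
      .comp (inputLetter t, q) :: w =
        pairTape (inputLetter t) (ts.map inputLetter ++ [.boundary]) ++ rest ∧
      (valcProgram M).Accepts ⟨.inl 3, .check .sync .boundary, .ctrl .waiting, .ctrl .lagWait,
        rest, rest, w, .comp (.boundary, inputLetter t) :: .comp (inputLetter t, q) :: w⟩ n' := by
    rcases next_input_eq_some hs' with ⟨t', rfl, rfl⟩ | ⟨rfl, rfl⟩
    · rw [if_neg nofun] at h
      obtain ⟨ts, rest, n', hw, h'⟩ := scan_inv w h
      exact ⟨t' :: ts, rest, n', congrArg _ hw, h'⟩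
    · rw [if_pos rfl] at h
      exact ⟨[], _, n, rfl, h⟩
  clear h h₁
  obtain ⟨ts, rest, n', hw, h⟩ := key
  rw [hw] at h
  obtain ⟨ys, rest', p, q', re, n', rfl, hwalk, h⟩ := sync_inv h
  refine ⟨t, ts, ys, ?_, hwalk⟩
  rw [hw, pairTape_append_boundary]
  rw [pairTape_append_boundary] at hw
  -- The counting client has passed two pairs, so its remaining pairs start with the second letter
  -- `z` behind the initial boundary symbol.
  obtain ⟨z, vs, hz⟩ : ∃ z vs, ts.map inputLetter ++ Letter.boundary :: ys = z :: vs :=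
    List.exists_cons_of_ne_nil (by simp)
  rw [hz] at hw ⊢
  obtain ⟨-, hw⟩ := List.cons.inj hw
  obtain ⟨l, hl, hlen⟩ := pairTape_eq_map z vs
  change w = pairTape z vs ++ _ at hw
  rw [hw, hl] at h
  rw [afterDollar_inv h, hlen, List.map_cons, List.cons_append, hz, padded, List.length_cons,
    List.length_cons, doublingBlocks_succ]
  rfl

theorem accepts_padded {t : M.T} {ts : List M.T} {ys : List M.Letter}
    (h : Walk (.first 0) .boundary ((t :: ts).map inputLetter ++ [.boundary]) ys) :
    ∃ n ≤ 3 * ((t :: ts).map inputLetter ++ .boundary :: ys).length,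
      (valcProgram M).Accepts ((valcProgram M).initialRun
        (padded ((t :: ts).map inputLetter ++ .boundary :: ys))) n := by
  obtain ⟨z, vs, hz⟩ : ∃ z vs, ts.map inputLetter ++ Letter.boundary :: ys = z :: vs :=
    List.exists_cons_of_ne_nil (by simp)
  obtain ⟨l, hl, hlen⟩ := pairTape_eq_map z vs
  have hys : ts.length + ys.length = vs.length := by
    have := congrArg List.length hz
    simp at this
    omega
  -- The costs of the blocks, of the comparison and of `sync_accepts`. The word has l.length + 2
  -- pairs and ys.length ≤ l.length, hence the factor 3.
  refine ⟨(2 * l.length + 4) + ys.length + 2, ?_, ?_⟩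
  · simp
    omega
  · have h' := sync_accepts h fun p q re => afterDollar_accepts (p := p) (q := q) (l := l)
      (rest := .b :: .b :: blocksAfter 1 (l.length + 1)) (re := re)
    have hp : padded ((t :: ts).map inputLetter ++ .boundary :: ys) =
        .dollar₁ :: .comp (.boundary, inputLetter t) :: .comp (inputLetter t, z) ::
          (pairTape z vs ++ .dollar₂ :: .a :: .b :: .b :: blocksAfter 1 (l.length + 1)) := by
      rw [hlen, List.map_cons, List.cons_append, hz, padded, List.length_cons,
        List.length_cons, doublingBlocks_succ]
      rfl
    rw [pairTape_append_boundary, ← hl, List.map_cons, List.cons_append, hz] at h'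
    rw [hp]
    refine .of_work rfl rfl rfl rfl (.of_work (m' := .inr (.ctrl .scan)) (move_scan_inputLetter _ _ _)
      (move_check_of_next rfl _) rfl rfl ?_)
    rcases ts with _ | ⟨t', ts⟩
    · obtain ⟨rfl, rfl⟩ := List.cons.inj hz
      exact .of_work (m' := .inl 3) (move_scan_boundary _ _) (move_check_of_next rfl _) rfl rfl h'
    · obtain ⟨rfl, rfl⟩ := List.cons.inj hz
      have h'' := scan_accepts (rc := pairTape (inputLetter t') (ts.map inputLetter ++ .boundary :: ys)
        ++ .dollar₂ :: .a :: .b :: .b :: blocksAfter 1 (l.length + 1)) h' ts (y := inputLetter t')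
      rw [pairTape_append_boundary] at h''
      exact .of_work (m' := .inr (.ctrl .scan)) (move_scan_inputLetter _ _ _) (move_check_of_next rfl _) rfl rfl h''


/-! ## Sequences of subconfigurations -/

/-- The letter of a cell that is not the active one. -/
def stateLetter (s : M.State) : M.Letter := .cell (.st s)

/-- The letter is a single cell symbol. -/
def Plain : M.Letter → Prop
  | .cell _ => True
  | _ => False

theorem compat_boundary {p y : M.Letter} : Compat p .boundary y ↔ y = .boundary := Iff.rfl

theorem compat_of_plain {p q y : M.Letter} {s : M.State} (hp : Plain p) (hq : value q = some s) :
    Compat p q y ↔ y = stateLetter s := by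
  cases p <;> first | exact hp.elim | simp [Compat, hq, stateLetter]

theorem compat_after_boundary {q y : M.Letter} {s : M.State} (hq : value q = some s) :
    Compat .boundary q y ↔
      y = stateLetter s ∨ y = .pair (.st (M.δ none s)) (.st s) := by
  simp [Compat, hq, stateLetter]

theorem compat_after_pair {x : M.CellSym} {q y : M.Letter} {c s : M.State}
    (hq : value q = some s) :
    Compat (.pair x (.st c)) q y ↔ y = .pair (.st (M.δ (some c) s)) (.st s) := by
  simp [Compat, hq]

theorem walk_cons_cons {s : M.Phase} {p q y : M.Letter} {win ys : List M.Letter} :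
    Walk s p (q :: win) (y :: ys) ↔
      Compat p q y ∧ ∃ s', s.next y = some s' ∧ Walk s' q (win ++ [y]) ys := Iff.rfl

theorem walk_boundary {s : M.Phase} {p : M.Letter} {win ys : List M.Letter} :
    Walk s p (.boundary :: win) ys ↔ (ys = [] ∧ s.Final) ∨
      ∃ ys' s', ys = .boundary :: ys' ∧ s.next .boundary = some s' ∧
        Walk s' .boundary (win ++ [.boundary]) ys' := by
  rcases ys with _ | ⟨y, ys⟩
  · simp [Walk]
  · rw [walk_cons_cons, compat_boundary]
    constructor
    · rintro ⟨rfl, s', h⟩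
      exact .inr ⟨ys, s', rfl, h⟩
    · rintro (⟨h, -⟩ | ⟨ys', s', h, h'⟩)
      · cases h
      · cases h
        exact ⟨rfl, s', h'⟩

/-- At a letter with a value whose successor letter is known to be `z`. -/
theorem walk_step {s s' : M.Phase} {p q z : M.Letter} {win ys : List M.Letter}
    (hq : q ≠ .boundary) (hz : ∀ y s', Compat p q y ∧ s.next y = some s' → y = z)
    (hc : Compat p q z) (hs : s.next z = some s') :
    Walk s p (q :: win) ys ↔ ∃ ys', ys = z :: ys' ∧ Walk s' q (win ++ [z]) ys' := by
  rcases ys with _ | ⟨y, ys⟩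
  · simp [Walk, hq]
  · rw [walk_cons_cons]
    constructor
    · rintro ⟨h, s'', h', hw⟩
      obtain rfl := hz y s'' ⟨h, h'⟩
      obtain rfl : s' = s'' := by simpa [hs] using h'
      exact ⟨ys, rfl, hw⟩
    · rintro ⟨ys', h, hw⟩
      cases h
      exact ⟨hc, s', hs, hw⟩

/-- Collects forced letters: a forced first letter followed by a forced stretch `l` is again a
forced stretch, with the condition `C` on what remains. -/
theorem walk_step_append {s s' : M.Phase} {p q z : M.Letter} {win ys l : List M.Letter}
    {C : List M.Letter → Prop}
    (hq : q ≠ .boundary) (hz : ∀ y s', Compat p q y ∧ s.next y = some s' → y = z)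
    (hc : Compat p q z) (hs : s.next z = some s')
    (h : ∀ ys, Walk s' q (win ++ [z]) ys ↔ ∃ ys', ys = l ++ ys' ∧ C ys') :
    Walk s p (q :: win) ys ↔ ∃ ys', ys = z :: l ++ ys' ∧ C ys' := by
  rw [walk_step hq hz hc hs]
  simp only [h]
  constructor
  · rintro ⟨_, rfl, ys', rfl, h⟩
    exact ⟨ys', rfl, h⟩
  · rintro ⟨ys', rfl, h⟩
    exact ⟨_, rfl, ys', rfl, h⟩

theorem ne_boundary_of_value {q : M.Letter} {s : M.State} (h : value q = some s) :
    q ≠ .boundary := by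
  rintro rfl
  cases h

/-- The part of a subconfiguration after the active cell is copied. -/
theorem walk_copy (L : List M.Letter) : ∀ {vals : List M.State} {k : Fin 4} {s : M.Phase}
    {p : M.Letter} {w ys : List M.Letter}, L.map value = vals.map some →
    (∀ x ∈ (p :: L).dropLast, Plain x) →
    (∀ v, s.next (stateLetter v) = some (.trail k)) →
    (Walk s p (L ++ .boundary :: w) ys ↔ ∃ ys', ys = vals.map stateLetter ++ ys' ∧
      Walk (if vals = [] then s else .trail k) .boundary
        (.boundary :: w ++ vals.map stateLetter) ys') := by
  induction L with
  | nil =>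
    intro vals k s p w ys hv hp hs
    obtain rfl : vals = [] := by simpa using hv.symm
    simp only [List.nil_append, List.map_nil, List.append_nil, if_true, exists_eq_left']
    rw [walk_boundary, walk_boundary]
  | cons q L ih =>
    intro vals k s p w ys hv hp hs
    rcases vals with _ | ⟨v, vals⟩
    · simp at hv
    obtain ⟨hq, hv⟩ := List.cons.inj hv
    -- Only left neighbours must be plain; the last letter of the part to be copied may be the
    -- active pair that ended the previous sweep.
    have hpp : Plain p := hp p (by simp)
    rw [List.cons_append, List.map_cons, if_neg (List.cons_ne_nil v vals)]
    refine walk_step_append (ne_boundary_of_value hq)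
      (fun y s' h => (compat_of_plain hpp hq).1 h.1) ((compat_of_plain hpp hq).2 rfl) (hs v)
      fun ys => ?_
    have h := ih (ys := ys) (w := w ++ [stateLetter v]) (s := .trail k) (p := q) hv
      (fun x hx => hp x (by simp [hx])) (fun _ => rfl)
    simpa using h

variable (M) in
/-- A subconfiguration: the states before the active cell, the new and the old state of the active
cell, and the states after the active cell. -/
structure Sub where
  before : List M.State
  new : M.State
  old : M.State
  after : List M.State

namespace Sub

/-- The letters of a subconfiguration without the boundary symbol. -/
def letters (u : M.Sub) : List M.Letter :=
  u.before.map stateLetter ++ .pair (.st u.new) (.st u.old) :: u.after.map stateLetter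

/-- The first subconfiguration of the step from a configuration. -/
def ofConfig (e : M.State) (r : List M.State) : M.Sub := ⟨[], M.δ none e, e, r⟩

/-- The next subconfiguration. -/
def next (u : M.Sub) : M.Sub :=
  match u.after, u.before with
  | s :: a, b => ⟨b ++ [u.new], M.δ (some u.old) s, s, a⟩
  | [], [] => ofConfig u.new []
  | [], e :: b => ofConfig e (b ++ [u.new])

/-- The phase in which the shape checking automaton is after reading a subconfiguration. -/
def endPhase (u : M.Sub) (k : Fin 4) : M.Phase :=
  if u.after = [] then .just u.new k else .trail k

/-- The phase after the boundary symbol that follows a subconfiguration. -/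
def nextPhase (u : M.Sub) (k : Fin 4) : M.Phase :=
  if u.after = [] then .first k else .lead₀ k

/-- The number of sweeps, after the subconfiguration that follows `u`. -/
def nextCount (u : M.Sub) (k : Fin 4) : Fin 4 :=
  if u.after = [] then bump k else k

theorem next_endPhase (u : M.Sub) (k : Fin 4) :
    (u.endPhase k).next .boundary = some (u.nextPhase k) := by
  unfold endPhase nextPhase
  split_ifs <;> rfl

theorem final_endPhase_iff (u : M.Sub) (k : Fin 4) :
    (u.endPhase k).Final ↔ u.after = [] ∧ u.new ∈ M.F ∧ k = 3 := by
  unfold endPhase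
  split_ifs with h <;> simp [Phase.Final, h]

end Sub

/-! ### From one subconfiguration to the next -/

theorem map_value_map_stateLetter (l : List M.State) :
    (l.map stateLetter).map value = l.map some := by
  simp [stateLetter, value]

/-- The first subconfiguration of a step. -/
theorem walk_first {e : M.State} {r : List M.State} {q : M.Letter} {L w ys : List M.Letter}
    {k : Fin 4} (hq : value q = some e) (hL : L.map value = r.map some)
    (hp : ∀ x ∈ (q :: L).dropLast, Plain x) :
    Walk (.first k) .boundary (q :: L ++ .boundary :: w) ys ↔
      ∃ ys', ys = (Sub.ofConfig e r).letters ++ ys' ∧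
        Walk ((Sub.ofConfig e r).endPhase (bump k)) .boundary
          (.boundary :: w ++ (Sub.ofConfig e r).letters) ys' := by
  rw [List.cons_append]
  refine walk_step_append (l := r.map stateLetter) (z := .pair (.st (M.δ none e)) (.st e))
    (s' := .just (M.δ none e) (bump k)) (ne_boundary_of_value hq) ?_
    ((compat_after_boundary hq).2 (.inr rfl)) rfl fun ys => ?_
  · rintro y s' ⟨h, h'⟩
    -- In the phase `first` the shape automaton refuses a plain cell.
    rcases (compat_after_boundary hq).1 h with rfl | rfl
    · cases h'
    · rfl
  · have h := walk_copy L (ys := ys) (w := w ++ [.pair (.st (M.δ none e)) (.st e)])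
      (s := .just (M.δ none e) (bump k)) (k := bump k) (p := q) hL hp (fun _ => rfl)
    have e₁ : L ++ .boundary :: w ++ [.pair (.st (M.δ none e)) (.st e)] =
      L ++ .boundary :: (w ++ [.pair (.st (M.δ none e)) (.st e)]) := by simp
    have e₂ : .boundary :: w ++ (Sub.ofConfig e r).letters =
      .boundary :: (w ++ [.pair (.st (M.δ none e)) (.st e)]) ++ r.map stateLetter := by
        simp [Sub.letters, Sub.ofConfig]
    rw [e₁, e₂]
    exact h

/-- The active cell after the formerly active one. -/
theorem walk_active {d c s : M.State} {a : List M.State} {w ys : List M.Letter} {k : Fin 4} :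
    Walk (.lead k) (.pair (.st d) (.st c)) (stateLetter s :: (a.map stateLetter ++ .boundary :: w))
        ys ↔
      ∃ ys', ys = .pair (.st (M.δ (some c) s)) (.st s) :: a.map stateLetter ++ ys' ∧
        Walk (if a = [] then .just (M.δ (some c) s) k else .trail k) .boundary
          (.boundary :: w ++ .pair (.st (M.δ (some c) s)) (.st s) :: a.map stateLetter) ys' := by
  refine walk_step_append (s' := .just (M.δ (some c) s) k) (ne_boundary_of_value rfl)
    (fun y s' h => (compat_after_pair rfl).1 h.1) ((compat_after_pair rfl).2 rfl) rfl
    fun ys => ?_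
  have h := walk_copy (a.map stateLetter) (ys := ys)
    (w := w ++ [.pair (.st (M.δ (some c) s)) (.st s)])
    (s := .just (M.δ (some c) s) k) (k := k) (p := stateLetter s) (map_value_map_stateLetter a)
    (fun x hx => ?_) (fun _ => rfl)
  · simpa using h
  · rw [← List.map_cons] at hx
    obtain ⟨v, -, rfl⟩ := List.mem_map.1 (List.mem_of_mem_dropLast hx)
    trivial

/-- The active cell moves to the right. -/
theorem walk_lead (b : List M.State) : ∀ {p : M.Letter} {d c s : M.State} {a : List M.State}
    {w ys : List M.Letter} {k : Fin 4}, Plain p →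
    (Walk (.lead k) p (b.map stateLetter ++ .pair (.st d) (.st c) :: stateLetter s ::
        (a.map stateLetter ++ .boundary :: w)) ys ↔
      ∃ ys', ys = (Sub.mk (b ++ [d]) (M.δ (some c) s) s a).letters ++ ys' ∧
        Walk ((Sub.mk (b ++ [d]) (M.δ (some c) s) s a).endPhase k) .boundary
          (.boundary :: w ++ (Sub.mk (b ++ [d]) (M.δ (some c) s) s a).letters) ys') := by
  induction b with
  | nil =>
    intro p d c s a w ys k hp
    refine walk_step_append (l := .pair (.st (M.δ (some c) s)) (.st s) :: a.map stateLetter)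
      (z := stateLetter d) (s' := .lead k) (ne_boundary_of_value rfl)
      (fun y s' h => (compat_of_plain hp rfl).1 h.1) ((compat_of_plain hp rfl).2 rfl) rfl
      fun ys => ?_
    have h := walk_active (ys := ys) (d := d) (c := c) (s := s) (a := a)
      (w := w ++ [stateLetter d]) (k := k)
    simpa [Sub.letters, Sub.endPhase] using h
  | cons e b ih =>
    intro p d c s a w ys k hp
    refine walk_step_append (l := (Sub.mk (b ++ [d]) (M.δ (some c) s) s a).letters)
      (z := stateLetter e) (s' := .lead k) (ne_boundary_of_value rfl)
      (fun y s' h => (compat_of_plain hp rfl).1 h.1) ((compat_of_plain hp rfl).2 rfl) rfl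
      fun ys => ?_
    have h := ih (ys := ys) (d := d) (c := c) (s := s) (a := a) (p := stateLetter e)
      (w := w ++ [stateLetter e]) (k := k) trivial
    simpa [Sub.letters, Sub.endPhase] using h

/-- If the last cell was active, a new sweep begins (`walk_first`). Otherwise the active cell moves
to the right, and the cases differ in whether letters precede the formerly active one. -/
theorem walk_next (u : M.Sub) {w ys : List M.Letter} {k : Fin 4} :
    Walk (u.nextPhase k) .boundary (u.letters ++ .boundary :: w) ys ↔
      ∃ ys', ys = u.next.letters ++ ys' ∧
        Walk (u.next.endPhase (u.nextCount k)) .boundary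
          (.boundary :: w ++ u.next.letters) ys' := by
  -- Behind a boundary symbol within a sweep the shape automaton refuses a pair.
  have lead₀ : ∀ {q y : M.Letter} {e : M.State} {s' : M.Phase}, value q = some e →
      Compat .boundary q y ∧ (Phase.lead₀ k).next y = some s' → y = stateLetter e := by
    rintro q y e s' hq ⟨h, h'⟩
    rcases (compat_after_boundary hq).1 h with rfl | rfl
    · rfl
    · cases h'
  obtain ⟨_ | ⟨e, b⟩, d, c, _ | ⟨s, a⟩⟩ := u
  · exact walk_first (q := .pair (.st d) (.st c)) (L := []) rfl rfl (by simp)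
  · refine walk_step_append (l := .pair (.st (M.δ (some c) s)) (.st s) :: a.map stateLetter)
      (z := stateLetter d) (s' := .lead k) (ne_boundary_of_value rfl)
      (fun y s' h => lead₀ rfl h) ((compat_after_boundary rfl).2 (.inl rfl)) rfl
      fun ys => ?_
    have h := walk_active (ys := ys) (d := d) (c := c) (s := s) (a := a)
      (w := w ++ [stateLetter d]) (k := k)
    simpa [Sub.letters, Sub.endPhase, Sub.next, Sub.nextCount] using h
  · have h := walk_first (q := stateLetter e) (e := e) (k := k) (w := w) (ys := ys)
      (L := b.map stateLetter ++ [.pair (.st d) (.st c)]) (r := b ++ [d]) rfl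
      (by simp [value, stateLetter]) (by
        rw [← List.cons_append, List.dropLast_concat]
        rintro x (_ | ⟨_, hx⟩)
        · trivial
        · obtain ⟨v, -, rfl⟩ := List.mem_map.1 hx
          trivial)
    exact h
  · refine walk_step_append (l := (Sub.mk (b ++ [d]) (M.δ (some c) s) s a).letters)
      (z := stateLetter e) (s' := .lead k) (ne_boundary_of_value rfl)
      (fun y s' h => lead₀ rfl h) ((compat_after_boundary rfl).2 (.inl rfl)) rfl
      fun ys => ?_
    have h := walk_lead b (ys := ys) (d := d) (c := c) (s := s) (a := a) (p := stateLetter e)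
      (w := w ++ [stateLetter e]) (k := k) trivial
    simpa [Sub.letters, Sub.endPhase, Sub.next, Sub.nextCount] using h

/-- The window is again a boundary symbol followed by one subconfiguration, so this step can be
iterated. -/
theorem walk_endPhase_iff (u : M.Sub) {ys : List M.Letter} {k : Fin 4} :
    Walk (u.endPhase k) .boundary (.boundary :: u.letters) ys ↔
      (ys = [] ∧ u.after = [] ∧ u.new ∈ M.F ∧ k = 3) ∨
      ∃ ys', ys = .boundary :: u.next.letters ++ ys' ∧
        Walk (u.next.endPhase (u.nextCount k)) .boundary (.boundary :: u.next.letters) ys' := by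
  rw [walk_boundary, u.final_endPhase_iff, u.next_endPhase]
  refine or_congr Iff.rfl ?_
  constructor
  · rintro ⟨ys', s', rfl, hs, h⟩
    cases hs
    obtain ⟨ys'', rfl, h'⟩ := (walk_next u (w := [])).1 h
    exact ⟨ys'', rfl, h'⟩
  · rintro ⟨ys', rfl, h⟩
    exact ⟨_, _, rfl, rfl, (walk_next u (w := [])).2 ⟨ys', rfl, h⟩⟩

/-- The walk through a sequence of subconfigurations. -/
theorem walk_iff_exists_range (U : ℕ → M.Sub) (K : ℕ → Fin 4) (hU : ∀ j, U (j + 1) = (U j).next)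
    (hK : ∀ j, K (j + 1) = (U j).nextCount (K j)) (j : ℕ) (ys : List M.Letter) :
    Walk ((U j).endPhase (K j)) .boundary (.boundary :: (U j).letters) ys ↔
      ∃ r, (U (j + r)).after = [] ∧ (U (j + r)).new ∈ M.F ∧ K (j + r) = 3 ∧
        ys = (List.range r).flatMap fun i => .boundary :: (U (j + 1 + i)).letters := by
  constructor
  · intro h
    induction hl : ys.length using Nat.strong_induction_on generalizing j ys with
    | _ l ih =>
      subst hl
      rcases (walk_endPhase_iff _).1 h with ⟨rfl, h'⟩ | ⟨ys', rfl, h'⟩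
      · exact ⟨0, h'.1, h'.2.1, h'.2.2, rfl⟩
      · rw [← hU, ← hK] at h'
        obtain ⟨r, h₁, h₂, h₃, rfl⟩ := ih _ (by simp) _ _ h' rfl
        refine ⟨r + 1, ?_, ?_, ?_, ?_⟩
        · rwa [← add_assoc, add_right_comm]
        · rwa [← add_assoc, add_right_comm]
        · rwa [← add_assoc, add_right_comm]
        · rw [List.range_succ_eq_map, List.flatMap_cons, List.flatMap_map]
          simp [hU, Nat.succ_eq_add_one, add_right_comm, add_assoc, add_comm 1]
  · rintro ⟨r, h₁, h₂, h₃, rfl⟩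
    induction r generalizing j with
    | zero => exact (walk_endPhase_iff _).2 (.inl ⟨rfl, h₁, h₂, h₃⟩)
    | succ r ih =>
      refine (walk_endPhase_iff _).2 (.inr ⟨(List.range r).flatMap
        fun i => .boundary :: (U (j + 1 + 1 + i)).letters, ?_, ?_⟩)
      · rw [List.range_succ_eq_map, List.flatMap_cons, List.flatMap_map]
        simp [hU, add_assoc, add_comm 1, add_comm 2]
      · rw [← hU, ← hK]
        apply ih
        · rwa [add_assoc, add_comm 1]
        · rwa [add_assoc, add_comm 1]
        · rwa [add_assoc, add_comm 1]


/-! ## The subconfigurations of a computation -/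

/-- The subconfiguration in the step from `c` in which cell `i` is active. -/
def subAt {n : ℕ} (c : Fin n → M.State) (i : Fin n) : M.Sub where
  before := (List.ofFn (M.step c)).take i
  new := M.step c i
  old := c i
  after := (List.ofFn c).drop (i + 1)

theorem boundary_cons_letters_subAt {n : ℕ} (c : Fin n → M.State) (i : Fin n) :
    .boundary :: (subAt c i).letters = M.subconfig c (M.step c) i := by
  rw [subconfig, Sub.letters, subAt]
  have hi := i.isLt
  refine congrArg _ (List.ext_getElem (by simp; omega) fun j h₁ h₂ => ?_)
  have hj : j < n := by simpa using h₂
  simp only [List.getElem_ofFn, Fin.lt_def, Fin.ext_iff]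
  split_ifs with h h'
  · rw [List.getElem_append_left (by simp; omega)]
    simp [stateLetter]
  · subst h'
    rw [List.getElem_append_right (by simp)]
    simp [hi.le]
  · rw [List.getElem_append_right (by simp; omega), List.getElem_cons, dif_neg (by simp; omega)]
    simp only [List.length_map, List.length_take, List.length_ofFn, List.getElem_map,
      List.getElem_drop, List.getElem_ofFn, stateLetter]
    congr 3
    apply Fin.ext
    simp
    omega

/-- The active pair still shows the old state of cell `i`, which is the neighbour state that
`M.step` uses for cell `i + 1`. -/
theorem next_subAt_of_lt {n : ℕ} (c : Fin n → M.State) (i : ℕ) (h : i + 1 < n) :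
    (subAt c ⟨i, by omega⟩).next = subAt c ⟨i + 1, h⟩ := by
  have h₁ : (List.ofFn c).drop (i + 1) = c ⟨i + 1, h⟩ :: (List.ofFn c).drop (i + 1 + 1) := by
    rw [List.drop_eq_getElem_cons (by simpa using h), List.getElem_ofFn]
  have h₂ : (List.ofFn (M.step c)).take (i + 1) =
      (List.ofFn (M.step c)).take i ++ [M.step c ⟨i, by omega⟩] := by
    rw [List.take_succ_eq_append_getElem (by simp; omega), List.getElem_ofFn]
  simp only [subAt, Sub.next, h₁, h₂]
  simp [step]

/-- Once the last cell is updated, the states before it together with its new state form the whole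
configuration `M.step c`, from which the next sweep starts. -/
theorem next_subAt_last {n : ℕ} (c : Fin (n + 1) → M.State) :
    (subAt c (Fin.last n)).next = subAt (M.step c) 0 := by
  have h₁ : (List.ofFn c).drop (n + 1) = [] := by simp
  have h₂ : (List.ofFn (M.step c)).take n ++ [M.step c (Fin.last n)] =
      M.step c 0 :: (List.ofFn (M.step c)).drop 1 := by
    have e : List.ofFn (M.step c) = (List.ofFn (M.step c)).take n ++ [M.step c (Fin.last n)] := by
      have := List.take_succ_eq_append_getElem (l := List.ofFn (M.step c)) (i := n) (by simp)
      rw [List.getElem_ofFn] at this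
      rw [← show (⟨n, _⟩ : Fin (n + 1)) = Fin.last n from rfl, ← this]
      simp
    rw [← e]
    simp [List.ofFn_succ]
  have h₃ : (subAt (M.step c) 0) = Sub.ofConfig (M.step c 0) ((List.ofFn (M.step c)).drop 1) := by
    simp [subAt, Sub.ofConfig, step]
  rw [h₃]
  simp only [subAt, Sub.next, Fin.val_last, h₁]
  rcases hb : (List.ofFn (M.step c)).take n with _ | ⟨e, b⟩
  · rw [hb] at h₂
    obtain ⟨e₁, e₂⟩ := List.cons.inj h₂
    rw [← e₂, ← e₁]
  · rw [hb] at h₂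
    obtain ⟨e₁, e₂⟩ := List.cons.inj h₂
    rw [← e₂, ← e₁]
    rfl

theorem subAt_after_eq_nil_iff {n : ℕ} (c : Fin (n + 1) → M.State) (i : Fin (n + 1)) :
    (subAt c i).after = [] ↔ i = Fin.last n := by
  simp [subAt, Fin.ext_iff]
  omega

/-- Numbers the subconfigurations consecutively: cell `i` in sweep `t` gets the index t * n + i. -/
theorem flatMap_range_mul {β : Type} (f : ℕ → List β) (m n : ℕ) :
    (List.range (m * n)).flatMap f =
      (List.range m).flatMap fun t => (List.ofFn fun i : Fin n => f (t * n + i)).flatten := by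
  induction m with
  | zero => simp
  | succ m ih =>
    rw [Nat.succ_mul, List.range_add, List.flatMap_append, ih, List.range_succ, List.flatMap_append,
      List.flatMap_map]
    simp [List.flatMap_def, List.ofFn_eq_map, ← List.map_coe_finRange_eq_range, Function.comp_def]

/-- The `j`th subconfiguration of the computation on `x`. -/
def subSeq {n : ℕ} (x : Fin (n + 1) → M.T) (j : ℕ) : M.Sub :=
  subAt (M.config x (j / (n + 1))) ⟨j % (n + 1), Nat.mod_lt _ n.succ_pos⟩

/-- The number of sweeps, up to three, that have been started at the `j`th subconfiguration. -/
def sweepCount (n j : ℕ) : Fin 4 := ⟨min (j / (n + 1) + 1) 3, by omega⟩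

theorem subSeq_mul_add {n : ℕ} (x : Fin (n + 1) → M.T) (t : ℕ) (i : Fin (n + 1)) :
    subSeq x (t * (n + 1) + i) = subAt (M.config x t) i := by
  have h₁ : (t * (n + 1) + i) / (n + 1) = t := by
    rw [mul_comm, Nat.mul_add_div n.succ_pos, Nat.div_eq_of_lt i.isLt, add_zero]
  have h₂ : (t * (n + 1) + i) % (n + 1) = i := by
    rw [mul_comm, Nat.mul_add_mod, Nat.mod_eq_of_lt i.isLt]
  simp only [subSeq, h₁, h₂]

theorem computationWord_eq {n : ℕ} (x : Fin (n + 1) → M.T) (m : ℕ) :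
    M.computationWord x m = M.initialWord x ++ (List.range (m * (n + 1))).flatMap
      fun j => .boundary :: (subSeq x j).letters := by
  rw [flatMap_range_mul]
  simp only [subSeq_mul_add, boundary_cons_letters_subAt]
  rfl

theorem subSeq_succ {n : ℕ} (x : Fin (n + 1) → M.T) (j : ℕ) :
    subSeq x (j + 1) = (subSeq x j).next := by
  obtain ⟨t, i, hi, rfl⟩ : ∃ t i, i < n + 1 ∧ j = t * (n + 1) + i :=
    ⟨j / (n + 1), j % (n + 1), Nat.mod_lt _ n.succ_pos, (Nat.div_add_mod' j (n + 1)).symm⟩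
  rw [subSeq_mul_add x t ⟨i, hi⟩]
  rcases Nat.lt_or_ge (i + 1) (n + 1) with h | h
  · rw [next_subAt_of_lt _ i h]
    exact subSeq_mul_add x t ⟨i + 1, h⟩
  · obtain rfl : i = n := by omega
    have h' := subSeq_mul_add x (t + 1) 0
    rw [Fin.val_zero, add_zero, Nat.succ_mul] at h'
    exact h'.trans (next_subAt_last _).symm

theorem subSeq_after_eq_nil_iff {n : ℕ} (x : Fin (n + 1) → M.T) (j : ℕ) :
    (subSeq x j).after = [] ↔ j % (n + 1) = n := by
  rw [subSeq, subAt_after_eq_nil_iff, Fin.ext_iff, Fin.val_last]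

theorem sweepCount_succ {n : ℕ} (x : Fin (n + 1) → M.T) (j : ℕ) :
    sweepCount n (j + 1) = (subSeq x j).nextCount (sweepCount n j) := by
  -- The quotient grows exactly when `j` is the last index of a sweep.
  have hd : (j + 1) / (n + 1) = if j % (n + 1) = n then j / (n + 1) + 1 else j / (n + 1) := by
    rw [Nat.succ_div]
    have hlt : j % (n + 1) < n + 1 := Nat.mod_lt j n.succ_pos
    have h : n + 1 ∣ j + 1 ↔ j % (n + 1) = n := by
      rw [← Nat.div_add_mod j (n + 1), add_assoc, Nat.dvd_add_right (Nat.dvd_mul_right _ _),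
        Nat.div_add_mod]
      refine ⟨fun h => ?_, fun h => by rw [h]⟩
      have := Nat.le_of_dvd (Nat.succ_pos _) h
      omega
    simp only [h]
    split_ifs <;> rfl
  simp only [Sub.nextCount, subSeq_after_eq_nil_iff, sweepCount, hd, bump]
  split_ifs
  · apply Fin.ext
    simp
    omega
  · rfl

/-- The letters after the initial configuration and a boundary symbol pass all checks if and only
if they complete a valid computation. -/
theorem walk_iff_exists_computationWord {n : ℕ} (x : Fin (n + 1) → M.T) (ys : List M.Letter) :
    Walk (.first 0) .boundary ((List.ofFn x).map inputLetter ++ [.boundary]) ys ↔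
      ∃ m, 3 ≤ m ∧ M.config x m (Fin.last n) ∈ M.F ∧
        M.computationWord x m = .boundary :: ((List.ofFn x).map inputLetter ++ .boundary :: ys) := by
  have h0 : subSeq x 0 = Sub.ofConfig (x 0) ((List.ofFn fun i : Fin n => x i.succ).map (↑)) := by
    have h := subSeq_mul_add x 0 0
    simp only [zero_mul, Fin.val_zero, add_zero] at h
    rw [h]
    simp [subAt, Sub.ofConfig, step, config, Function.comp_def]
  have hw : ∀ r, M.initialWord x ++ (List.range (r + 1)).flatMap
      (fun j => .boundary :: (subSeq x j).letters) = .boundary :: ((List.ofFn x).map inputLetter ++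
        .boundary :: ((subSeq x 0).letters ++ (List.range r).flatMap
          fun j => .boundary :: (subSeq x (0 + 1 + j)).letters)) := by
    intro r
    rw [List.range_succ_eq_map, List.flatMap_cons, List.flatMap_map]
    simp [initialWord, inputLetter, List.map_ofFn, Function.comp_def, add_comm]
  have hfirst := walk_first (q := inputLetter (x 0)) (e := x 0) (k := 0) (w := []) (ys := ys)
    (L := (List.ofFn fun i : Fin n => x i.succ).map inputLetter)
    (r := (List.ofFn fun i : Fin n => x i.succ).map (↑)) rfl
    (by rw [List.map_map, List.map_map]; rfl) (fun y hy => by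
      rw [← List.map_cons] at hy
      obtain ⟨v, -, rfl⟩ := List.mem_map.1 (List.mem_of_mem_dropLast hy)
      trivial)
  rw [← h0] at hfirst
  rw [List.ofFn_succ, List.map_cons, hfirst, ← List.map_cons, ← List.ofFn_succ]
  have hseq := walk_iff_exists_range (subSeq x) (sweepCount n) (subSeq_succ x) (sweepCount_succ x) 0
  have hb : bump 0 = sweepCount n 0 := by
    simp [bump, sweepCount]
  rw [hb]
  constructor
  · rintro ⟨ys', rfl, h⟩
    obtain ⟨r, h₁, h₂, h₃, rfl⟩ := (hseq ys').1 h
    rw [zero_add] at h₁ h₂ h₃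
    rw [subSeq_after_eq_nil_iff] at h₁
    -- The index `r` of the last subconfiguration ends a sweep, so r / (n + 1) + 1 sweeps are
    -- complete.
    refine ⟨r / (n + 1) + 1, ?_, ?_, ?_⟩
    · have := congrArg Fin.val h₃
      simp [sweepCount] at this
      omega
    · have e : (⟨r % (n + 1), Nat.mod_lt _ n.succ_pos⟩ : Fin (n + 1)) = Fin.last n := Fin.ext h₁
      rw [subSeq, e] at h₂
      exact h₂
    · have e : (r / (n + 1) + 1) * (n + 1) = r + 1 := by
        have := Nat.div_add_mod' r (n + 1)
        rw [Nat.succ_mul]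
        omega
      rw [computationWord_eq, e, hw]
  · rintro ⟨m, hm, hF, h⟩
    obtain ⟨m, rfl⟩ : ∃ m', m = m' + 1 := ⟨m - 1, by omega⟩
    have e : (m + 1) * (n + 1) = (m * (n + 1) + n) + 1 := by ring
    rw [computationWord_eq, e, hw] at h
    have h := List.append_cancel_left (List.cons.inj h).2
    have hlast : subSeq x (m * (n + 1) + n) = subAt (M.config x m) (Fin.last n) :=
      subSeq_mul_add x m (Fin.last n)
    -- With m + 1 sweeps, the last subconfiguration has sweep number m and active cell n, counted
    -- from zero.
    refine ⟨_, (List.cons.inj h).2.symm, (hseq _).2 ⟨m * (n + 1) + n, ?_, ?_, ?_, rfl⟩⟩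
    · rw [zero_add, hlast, subAt_after_eq_nil_iff]
    · rw [zero_add, hlast]
      exact hF
    · rw [zero_add]
      apply Fin.ext
      have : (m * (n + 1) + n) / (n + 1) = m := by
        rw [mul_comm, Nat.mul_add_div n.succ_pos, Nat.div_eq_of_lt n.lt_succ_self, add_zero]
      simp [sweepCount, this]
      omega

/-! ## The accepted language -/

theorem mem_VALCExp_iff (w : List M.TapeSym) :
    w ∈ M.VALCExp ↔ ∃ t ts ys, w = padded ((t :: ts).map inputLetter ++ .boundary :: ys) ∧
      Walk (.first 0) .boundary ((t :: ts).map inputLetter ++ [.boundary]) ys := by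
  have hpad : ∀ V : List M.Letter, [TapeSym.dollar₁] ++ (pairUp (.boundary :: V)).map .comp ++
      [.dollar₂] ++ M.doublingBlocks (pairUp (.boundary :: V)).length ++ [.amp] = padded V := by
    intro V
    rw [map_pairUp_cons, padded]
    simp [pairUp]
  constructor
  · rintro ⟨_, ⟨n, x, m, hm, hF, rfl⟩, -, rfl⟩
    -- At least one subconfiguration follows the initial one and supplies the second boundary
    -- symbol, where the word is split.
    obtain ⟨m', hm'⟩ : ∃ m', m * (n + 1) = m' + 1 :=
      ⟨m * (n + 1) - 1, (Nat.sub_add_cancel (Nat.mul_pos (by omega) n.succ_pos)).symm⟩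
    obtain ⟨ys, hys⟩ : ∃ ys, M.computationWord x m =
        .boundary :: ((List.ofFn x).map inputLetter ++ .boundary :: ys) := by
      rw [computationWord_eq, hm', List.range_succ_eq_map, List.flatMap_cons]
      exact ⟨_, by
        simp only [initialWord, List.map_ofFn, List.cons_append, Function.comp_def, inputLetter]
        rfl⟩
    refine ⟨x 0, List.ofFn fun i => x i.succ, ys, ?_, ?_⟩
    · rw [← List.ofFn_succ, ← hpad, hys]
    · rw [← List.ofFn_succ]
      exact (walk_iff_exists_computationWord x ys).2 ⟨m, hm, hF, hys⟩
  · rintro ⟨t, ts, ys, rfl, h⟩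
    have hx : List.ofFn (fun i : Fin (ts.length + 1) => (t :: ts)[i.val]) = t :: ts :=
      List.ofFn_getElem (xs := t :: ts)
    rw [← hx] at h ⊢
    obtain ⟨m, hm, hF, hys⟩ := (walk_iff_exists_computationWord _ ys).1 h
    refine ⟨_, ⟨_, _, m, hm, hF, rfl⟩, ?_, ?_⟩
    · rw [hys]
      simp [pairUp]
    · rw [hys, hpad]

/-- The block lengths sum to 2^m - 1, and the other symbols make up for the missing one. -/
theorem two_pow_le_length_padded (V : List M.Letter) : 2 ^ V.length ≤ (padded V).length := by
  have h : ∀ m, 2 ^ m ≤ (M.doublingBlocks m).length + 1 := by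
    intro m
    induction m with
    | zero => simp
    | succ m ih =>
      rw [doublingBlocks, List.range_succ, List.flatMap_append]
      rw [doublingBlocks] at ih
      simp only [List.length_append, List.flatMap_singleton, List.length_replicate, List.length_cons,
        List.length_nil, pow_succ]
      omega
  have := h V.length
  simp only [padded, List.length_cons, List.length_append, List.length_nil]
  omega

theorem log_mem_bigOLog (a : ℕ) : (fun n => a * Nat.log 2 n) ∈ bigOLog := by
  refine Asymptotics.IsBigO.of_bound (a / Real.log 2) (Filter.Eventually.of_forall fun n => ?_)
  have h : (Nat.log 2 n : ℝ) ≤ Real.log n / Real.log 2 := Real.natLog_le_logb n 2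
  have hn : 0 ≤ Real.log n := Real.log_natCast_nonneg n
  rw [Real.norm_of_nonneg (by positivity), Real.norm_of_nonneg hn, Nat.cast_mul,
    div_mul_eq_mul_div, mul_div_assoc]
  exact mul_le_mul_of_nonneg_left h (Nat.cast_nonneg a)

end OCA

theorem mainTheorem9 (M : OCA) : M.VALCExp ∈ DRCPCFAFamily bigOLog 4 M.TapeSym := by
  have hL : (OCA.valcProgram M).toDPCFA.language = M.VALCExp := by
    ext w
    rw [Program.mem_language_iff, OCA.mem_VALCExp_iff]
    constructor
    · rintro ⟨n, h⟩
      exact OCA.exists_of_accepts h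
    · rintro ⟨t, ts, ys, rfl, h⟩
      obtain ⟨n, -, h⟩ := OCA.accepts_padded h
      exact ⟨n, h⟩
  refine ⟨(OCA.valcProgram M).toDPCFA, Program.centralized _, ⟨_, OCA.log_mem_bigOLog 3, ?_⟩, hL⟩
  intro w hw
  rw [hL, OCA.mem_VALCExp_iff] at hw
  obtain ⟨t, ts, ys, rfl, h⟩ := hw
  obtain ⟨n, hn, h⟩ := OCA.accepts_padded h
  obtain ⟨T, c, hc, hq⟩ := Program.exists_computation_of_accepts _ h
  -- At most three queries per pair, and the number of pairs is at most the binary logarithm of the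
  -- length of the input.
  refine ⟨T, c, hc, hq.trans (hn.trans (Nat.mul_le_mul_left 3 ?_))⟩
  exact Nat.le_log_of_pow_le one_lt_two (OCA.two_pow_le_length_padded _)
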